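/- **Theorem 5.1.** In the undirected bounded-degree graph model, testing $3$-colorability requires $\Omega(N)$ quantum queries, for every degree bound $d\ge 4$ and every sufficiently small proximity parameter $\varepsilon$, where the constant in $\Omega(\cdot)$ may depend on $d$ and $\varepsilon$. Precisely: for every integer $d\ge 4$ there is $\varepsilon_0\in(0,1)$ such that for every $\varepsilon\in(0,\varepsilon_0]$ there are $c>0$ and $N_0$ such that for every $N\ge N_0$, every quantum query algorithm that is an $\varepsilon$-tester for $3$-colorability of $N$-vertex graphs of maximum degree at most $d$ makes at least $cN$ queries. Here: * A simple undirected graph $G$ on $V=\{0,\dots,N-1\}$ with maximum degree at most $d$ is given by an adjacency-list oracle $x: V\times[d]\to V\cup\{\bot\}$: for each $v$ the neighbours of $v$ are listed in some order without repetition, $x(v,i)$ is the $i$-th neighbour of $v$ if $i\le\deg(v)$, and $x(v,i)=\bot$ if $i>\deg(v)$. * $G$ is $\varepsilon$-far from $3$-colorable if $|E(G)\,\triangle\,E(H)|\ge\varepsilon N d$ for every $3$-colorable graph $H$ on $V$ of maximum degree at most $d$. * A quantum query algorithm with $T$ queries acts on a finite-dimensional space with orthonormal basis $|i\rangle|z\rangle|w\rangle$,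 where $i\in V\times[d]$ and $z,w$ range over finite sets. It starts in a fixed basis state, applies $U_T O_x U_{T-1}\cdots O_x U_0$ with unitaries $U_t$ independent of $x$ and $O_x|i\rangle|z\rangle|w\rangle=|i\rangle|z\oplus x(i)\rangle|w\rangle$, measures in this basis, and accepts if the outcome is in a fixed set. The operation $\oplus$ may be any reversible one: for each $s\in V\cup\{\bot\}$ the map $z\mapsto z\oplus s$ is a permutation. The lower bound holds for every choice of $\oplus$. * The algorithm is an $\varepsilon$-tester if, for all such $G$ and all adjacency-list oracles $x$ of $G$, it accepts with probability at least $2/3$ when $G$ is $3$-colorable, and with probability at most $1/3$ when $G$ is $\varepsilon$-far from $3$-colorable. -/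

import Mathlib

open scoped Matrix

/-- A quantum query algorithm on inputs indexed by `I`, acting on a query register with basis `I`,
an answer register with basis `Z` and a workspace register with basis `W`.
It makes `queries` oracle calls, interleaved with the unitaries `U 0, …, U queries`, none of which
depends on the input (the values `U t` with `queries < t` play no role).
It starts in the basis state `start`; at the end the state is measured in the computational basis
and the algorithm accepts iff the outcome lies in `accept`. -/
structure QuantumQueryAlgorithm (I Z W : Type) [Fintype I] [DecidableEq I]
    [Fintype Z] [DecidableEq Z] [Fintype W] [DecidableEq W] where
  queries : ℕ
  start : I × Z × W
  U : ℕ → Matrix.unitaryGroup (I × Z × W) ℂ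
  accept : Finset (I × Z × W)

namespace QuantumQueryAlgorithm

variable {I S Z W : Type} [Fintype I] [DecidableEq I] [Fintype Z] [DecidableEq Z]
  [Fintype W] [DecidableEq W]

/-- The query unitary `|i⟩|z⟩|w⟩ ↦ |i⟩|z ⊕ x i⟩|w⟩`, where the reversible operation `⊕` is given by
the permutations `op s : z ↦ z ⊕ s` of the basis of the answer register. -/
def applyOracle (op : S → Equiv.Perm Z) (x : I → S) (ψ : I × Z × W → ℂ) : I × Z × W → ℂ :=
  fun b => ψ (b.1, (op (x b.1)).symm b.2.1, b.2.2)

/-- The state of the algorithm on input `x` after `t` queries (and the unitary following the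
`t`-th query). -/
def state (A : QuantumQueryAlgorithm I Z W) (op : S → Equiv.Perm Z) (x : I → S) :
    ℕ → (I × Z × W → ℂ)
  | 0 => (A.U 0 : Matrix (I × Z × W) (I × Z × W) ℂ) *ᵥ Pi.single A.start 1
  | t + 1 => (A.U (t + 1) : Matrix (I × Z × W) (I × Z × W) ℂ) *ᵥ
      applyOracle op x (A.state op x t)

/-- The probability that the algorithm accepts the input `x`. -/
noncomputable def acceptProb (A : QuantumQueryAlgorithm I Z W) (op : S → Equiv.Perm Z)
    (x : I → S) : ℝ :=
  ∑ b ∈ A.accept, ‖A.state op x A.queries b‖ ^ 2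

end QuantumQueryAlgorithm

/-- Every vertex of `G` has at most `d` neighbours. -/
def DegreeBounded {V : Type} (d : ℕ) (G : SimpleGraph V) : Prop :=
  ∀ v, (G.neighborSet v).Finite ∧ (G.neighborSet v).ncard ≤ d

/-- `x : V × [d] → V ∪ {⊥}` is an adjacency-list oracle for `G`: for every vertex `v`, the
neighbours of `v` are listed without repetition, in some order, and `x (v, i)` is the `i`-th of
them (counting from `0`) if there is one, and `⊥ = none` otherwise. -/
def IsAdjacencyOracle {V : Type} {d : ℕ} (G : SimpleGraph V) (x : V × Fin d → Option V) : Prop :=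
  ∀ v, ∃ l : List V, l.Nodup ∧ (∀ w, w ∈ l ↔ G.Adj v w) ∧ ∀ i : Fin d, x (v, i) = l[(i : ℕ)]?

/-- `G` is `ε`-far from `3`-colorable in the model with degree bound `d`: it differs in at least
`ε * |V| * d` edges from every `3`-colorable graph of maximum degree at most `d` on the same
vertex set. -/
def FarFromThreeColorable {V : Type} [Fintype V] (ε : ℝ) (d : ℕ) (G : SimpleGraph V) : Prop :=
  ∀ H : SimpleGraph V, DegreeBounded d H → H.Colorable 3 →
    ε * ((Fintype.card V : ℝ) * (d : ℝ)) ≤ ((symmDiff G.edgeSet H.edgeSet).ncard : ℝ)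

/-- The algorithm `A` is an `ε`-tester for `3`-colorability of graphs on the vertex set `V` with
maximum degree at most `d`, given query access to an adjacency-list oracle of the graph. -/
def IsThreeColorabilityTester {V Z W : Type} [Fintype V] [DecidableEq V]
    [Fintype Z] [DecidableEq Z] [Fintype W] [DecidableEq W] (ε : ℝ) (d : ℕ)
    (op : Option V → Equiv.Perm Z) (A : QuantumQueryAlgorithm (V × Fin d) Z W) : Prop :=
  ∀ (G : SimpleGraph V) (x : V × Fin d → Option V),
    DegreeBounded d G → IsAdjacencyOracle G x →
      (G.Colorable 3 → 2 / 3 ≤ A.acceptProb op x) ∧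
      (FarFromThreeColorable ε d G → A.acceptProb op x ≤ 1 / 3)

/-! The proof combines the polynomial method with a local reduction from sparse systems of parity
checks over `ZMod 2`. A system has `16 * q` checks of four variables each and `4 * q` variables,
each in 16 checks. The left hand sides are fixed and the right hand sides `b` are the hidden input.
A system becomes a graph of maximum degree at most 4 on `87360 * q` vertices, padded with isolated
vertices, in which every oracle entry depends on one bit of `b`.

The acceptance probability after `T` queries is therefore a polynomial of degree at most `2 * T` in
the signs of the bits of `b` (`acceptProb_mem_lowDegree`). If no nonempty set of at most `2 * T`
checks is linearly dependent, such a polynomial has the same mean over all `b` as over the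
satisfiable `b` (`card_mul_sum_eq_of_lowDegree`). A union bound over random permutations gives left
hand sides with this property whenever `T * 2 ^ 30 ≤ q` (`exists_perms_odd_fiber`).

Satisfiable systems give 3-colorable graphs (`colorable_checkGraph`), so the mean over them is at
least 2/3. At least three quarters of all `b` violate more than `q` checks under every assignment
(`four_mul_card_near_le`), and then the graph is far from 3-colorable
(`farFromThreeColorable_checkGraph`), so the mean over all `b` is at most 1/3 + 2/3 · 1/4 = 1/2.
Hence a tester needs more than `q / 2 ^ 30` queries.

In the reduction, a 3-coloring of a 3 × 3 rook graph is a Latin square, which encodes two bits: the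
cyclic orientations of its rows and of its columns. Two squares hold the four variables of a check;
triangles enforce the parity (`sum_siteSign`), and matchings between lines of different gadgets
transport the bits (`siteSign_eq_of_link`). Chains of blocks copy colors and keep the degree at most
4 (`chain_color_eq`). -/

set_option linter.unusedSectionVars false
set_option linter.unusedSimpArgs false

/-! ### Parity characters and functions of low degree -/

/-- The character `a ↦ (-1) ^ a` of `ZMod 2`. -/
def bitSign (a : ZMod 2) : ℂ := if a = 0 then 1 else -1

theorem bitSign_add (a c : ZMod 2) : bitSign (a + c) = bitSign a * bitSign c := by
  have h : ∀ a : ZMod 2, a = 0 ∨ a = 1 := by decide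
  have h2 : (1 + 1 : ZMod 2) = 0 := rfl
  rcases h a with rfl | rfl <;> rcases h c with rfl | rfl <;> simp [bitSign, h2]

theorem bitSign_sum {ι : Type} (s : Finset ι) (f : ι → ZMod 2) :
    bitSign (∑ i ∈ s, f i) = ∏ i ∈ s, bitSign (f i) := by
  classical
  induction s using Finset.induction_on with
  | empty => simp [bitSign]
  | insert a s ha ih => rw [Finset.sum_insert ha, Finset.prod_insert ha, bitSign_add, ih]

theorem bitSign_mul_self (a : ZMod 2) : bitSign a * bitSign a = 1 := by
  unfold bitSign; split_ifs <;> simp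

theorem star_bitSign (a : ZMod 2) : star (bitSign a) = bitSign a := by
  unfold bitSign; split_ifs <;> simp

section LowDegree

variable {M : Type} [DecidableEq M]

/-- The character of `M → ZMod 2` indexed by a finite set of coordinates. -/
def parityChar (s : Finset M) (b : M → ZMod 2) : ℂ := ∏ i ∈ s, bitSign (b i)

theorem parityChar_mul (s t : Finset M) :
    parityChar s * parityChar t = parityChar (symmDiff s t) := by
  funext b
  simp only [Pi.mul_apply, parityChar]
  have hs : s = (s \ t) ∪ (s ∩ t) := by ext; simp; tauto
  have ht : t = (t \ s) ∪ (s ∩ t) := by ext; simp; tauto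
  have d1 : Disjoint (s \ t) (s ∩ t) := by
    rw [Finset.disjoint_left]; intro a; simp; tauto
  have d2 : Disjoint (t \ s) (s ∩ t) := by
    rw [Finset.disjoint_left]; intro a; simp; tauto
  have e1 : ∏ i ∈ s, bitSign (b i) =
      (∏ i ∈ s \ t, bitSign (b i)) * ∏ i ∈ s ∩ t, bitSign (b i) := by
    rw [← Finset.prod_union d1, ← hs]
  have e2 : ∏ i ∈ t, bitSign (b i) =
      (∏ i ∈ t \ s, bitSign (b i)) * ∏ i ∈ s ∩ t, bitSign (b i) := by
    rw [← Finset.prod_union d2, ← ht]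
  have e3 : (∏ i ∈ s ∩ t, bitSign (b i)) * ∏ i ∈ s ∩ t, bitSign (b i) = 1 := by
    rw [← Finset.prod_mul_distrib]
    exact Finset.prod_eq_one fun i _ => bitSign_mul_self _
  have d3 : Disjoint (s \ t) (t \ s) := disjoint_sdiff_sdiff
  have e4 : ∏ i ∈ symmDiff s t, bitSign (b i) =
      (∏ i ∈ s \ t, bitSign (b i)) * ∏ i ∈ t \ s, bitSign (b i) := by
    rw [← Finset.prod_union d3]; rfl
  rw [e1, e2, e4]
  linear_combination ((∏ i ∈ s \ t, bitSign (b i)) * ∏ i ∈ t \ s, bitSign (b i)) * e3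

/-- The functions on `M → ZMod 2` of degree at most `k`. -/
def lowDegree (M : Type) [DecidableEq M] (k : ℕ) : Submodule ℂ ((M → ZMod 2) → ℂ) :=
  Submodule.span ℂ (parityChar '' {s : Finset M | s.card ≤ k})

theorem parityChar_mem_lowDegree {s : Finset M} {k : ℕ} (h : s.card ≤ k) :
    parityChar s ∈ lowDegree M k :=
  Submodule.subset_span ⟨s, h, rfl⟩

theorem lowDegree_mono {k l : ℕ} (h : k ≤ l) : lowDegree M k ≤ lowDegree M l :=
  Submodule.span_mono (Set.image_mono fun _ hs => le_trans hs h)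

theorem mul_mem_lowDegree {k l : ℕ} {f g : (M → ZMod 2) → ℂ} (hf : f ∈ lowDegree M k)
    (hg : g ∈ lowDegree M l) : f * g ∈ lowDegree M (k + l) := by
  have h := Submodule.mul_mem_mul hf hg
  rw [lowDegree, lowDegree, Submodule.span_mul_span] at h
  refine Submodule.span_mono ?_ h
  rintro _ ⟨_, ⟨s, hs, rfl⟩, _, ⟨t, ht, rfl⟩, rfl⟩
  refine ⟨symmDiff s t, ?_, (parityChar_mul s t).symm⟩
  have : (symmDiff s t).card ≤ s.card + t.card :=
    (Finset.card_le_card (symmDiff_le_sup (a := s) (b := t))).trans (Finset.card_union_le s t)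
  exact this.trans (add_le_add hs ht)

theorem star_mem_lowDegree {k : ℕ} {f : (M → ZMod 2) → ℂ} (hf : f ∈ lowDegree M k) :
    star f ∈ lowDegree M k := by
  induction hf using Submodule.span_induction with
  | mem x h =>
    obtain ⟨s, hs, rfl⟩ := h
    have : star (parityChar s) = parityChar s := by
      funext b
      simp only [Pi.star_apply, parityChar, star_prod, star_bitSign]
    rw [this]
    exact parityChar_mem_lowDegree hs
  | zero => simp
  | add x y _ _ hx hy => rw [star_add]; exact add_mem hx hy
  | smul a x _ hx => rw [star_smul]; exact Submodule.smul_mem _ _ hx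

theorem const_mem_lowDegree (a : ℂ) (k : ℕ) : (fun _ => a) ∈ lowDegree M k := by
  have h : parityChar (∅ : Finset M) ∈ lowDegree M k := parityChar_mem_lowDegree (by simp)
  have := Submodule.smul_mem _ a h
  convert this using 1
  funext b
  simp [parityChar]

/-- Interpolation in one bit: the function is `(f + g) / 2 + χ (f - g) / 2`, where `χ` is the
character of the coordinate `j`. -/
theorem select_mem_lowDegree {k : ℕ} (j : M) {f g : (M → ZMod 2) → ℂ} (hf : f ∈ lowDegree M k)
    (hg : g ∈ lowDegree M k) :
    (fun b => if b j = 0 then f b else g b) ∈ lowDegree M (k + 1) := by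
  have hj : parityChar {j} ∈ lowDegree M 1 := parityChar_mem_lowDegree (by simp)
  have h1 := mul_mem_lowDegree (add_mem hf (Submodule.smul_mem _ (-1 : ℂ) hg)) hj
  have h2 := lowDegree_mono (Nat.le_succ k) (add_mem hf hg)
  have h3 := Submodule.smul_mem _ (1 / 2 : ℂ) (add_mem h1 h2)
  convert h3 using 1
  funext b
  simp only [parityChar, Finset.prod_singleton, bitSign, Pi.smul_apply, Pi.add_apply, Pi.mul_apply,
    smul_eq_mul]
  split_ifs <;> ring

end LowDegree

/-! ### The polynomial method for quantum queries -/

namespace QuantumQueryAlgorithm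

variable {I S Z W M : Type} [Fintype I] [DecidableEq I] [Fintype Z] [DecidableEq Z]
  [Fintype W] [DecidableEq W] [DecidableEq M]

theorem mulVec_mem_lowDegree {n : Type} [Fintype n] {k : ℕ} (A : Matrix n n ℂ)
    {ψ : (M → ZMod 2) → n → ℂ} (h : ∀ β, (fun b => ψ b β) ∈ lowDegree M k) (β : n) :
    (fun b => (A *ᵥ ψ b) β) ∈ lowDegree M k := by
  have : (fun b => (A *ᵥ ψ b) β) = ∑ γ, A β γ • fun b => ψ b γ := by
    funext b
    simp [Matrix.mulVec, dotProduct, Finset.sum_apply]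
  rw [this]
  exact Submodule.sum_mem _ fun γ _ => Submodule.smul_mem _ _ (h γ)

/-- The amplitudes after `t` queries have degree at most `t` in the bits that the answers of the
oracle are computed from. -/
theorem state_mem_lowDegree (A : QuantumQueryAlgorithm I Z W) (op : S → Equiv.Perm Z)
    (x : (M → ZMod 2) → I → S) (j : I → M) (hx : ∀ i b b', b (j i) = b' (j i) → x b i = x b' i)
    (t : ℕ) : ∀ β, (fun b => A.state op (x b) t β) ∈ lowDegree M t := by
  induction t with
  | zero =>
    intro β
    exact const_mem_lowDegree _ _
  | succ t ih =>
    refine mulVec_mem_lowDegree _ fun β => ?_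
    obtain ⟨i, z, w⟩ := β
    -- At a basis state with index `i`, the oracle only permutes `z`, in one of two ways chosen by
    -- the bit `j i`. One query thus selects between two earlier amplitudes, whatever `op` is.
    have key := select_mem_lowDegree (j i)
      (ih (i, (op (x 0 i)).symm z, w)) (ih (i, (op (x 1 i)).symm z, w))
    convert key using 1
    funext b
    simp only [applyOracle]
    split_ifs with h
    · rw [hx i b 0 (by simpa using h)]
    · rw [hx i b 1 (by
        have : ∀ a : ZMod 2, a ≠ 0 → a = 1 := by decide
        simpa using this _ h)]

/-- The probability is a sum of products of an amplitude and its conjugate, which doubles the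
degree. -/
theorem acceptProb_mem_lowDegree (A : QuantumQueryAlgorithm I Z W) (op : S → Equiv.Perm Z)
    (x : (M → ZMod 2) → I → S) (j : I → M)
    (hx : ∀ i b b', b (j i) = b' (j i) → x b i = x b' i) :
    (fun b => (A.acceptProb op (x b) : ℂ)) ∈ lowDegree M (A.queries + A.queries) := by
  have : (fun b => (A.acceptProb op (x b) : ℂ)) = ∑ β ∈ A.accept,
      (fun b => A.state op (x b) A.queries β) * star (fun b => A.state op (x b) A.queries β) := by
    funext b
    simp only [acceptProb, Finset.sum_apply, Pi.mul_apply, Pi.star_apply]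
    push_cast
    refine Finset.sum_congr rfl fun β _ => ?_
    exact (Complex.mul_conj' _).symm
  rw [this]
  refine Submodule.sum_mem _ fun β _ => ?_
  have h := A.state_mem_lowDegree op x j hx A.queries β
  exact mul_mem_lowDegree h (star_mem_lowDegree h)

theorem sum_norm_sq_unitary_mulVec {n : Type} [Fintype n] [DecidableEq n]
    (U : Matrix.unitaryGroup n ℂ) (ψ : n → ℂ) :
    ∑ β, ‖((U : Matrix n n ℂ) *ᵥ ψ) β‖ ^ 2 = ∑ β, ‖ψ β‖ ^ 2 := by
  have aux : ∀ φ : n → ℂ, ((∑ β, ‖φ β‖ ^ 2 : ℝ) : ℂ) = star φ ⬝ᵥ φ := by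
    intro φ
    simp only [dotProduct, Pi.star_apply]
    push_cast
    exact Finset.sum_congr rfl fun β _ => (Complex.conj_mul' _).symm
  have h : star ((U : Matrix n n ℂ) *ᵥ ψ) ⬝ᵥ ((U : Matrix n n ℂ) *ᵥ ψ) = star ψ ⬝ᵥ ψ := by
    rw [Matrix.star_mulVec, Matrix.dotProduct_mulVec, Matrix.vecMul_vecMul,
      ← Matrix.star_eq_conjTranspose, Matrix.UnitaryGroup.star_mul_self, Matrix.vecMul_one]
  rw [← aux, ← aux] at h
  exact_mod_cast h

theorem sum_norm_sq_applyOracle (op : S → Equiv.Perm Z) (x : I → S) (ψ : I × Z × W → ℂ) :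
    ∑ β, ‖applyOracle op x ψ β‖ ^ 2 = ∑ β, ‖ψ β‖ ^ 2 := by
  simp only [applyOracle, Fintype.sum_prod_type]
  refine Finset.sum_congr rfl fun i _ => ?_
  exact Equiv.sum_comp (op (x i)).symm fun z => ∑ w, ‖ψ (i, z, w)‖ ^ 2

theorem sum_norm_sq_state (A : QuantumQueryAlgorithm I Z W) (op : S → Equiv.Perm Z) (x : I → S)
    (t : ℕ) : ∑ β, ‖A.state op x t β‖ ^ 2 = 1 := by
  induction t with
  | zero =>
    rw [state, sum_norm_sq_unitary_mulVec]
    rw [Finset.sum_eq_single A.start] <;> simp +contextual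
  | succ t ih => rw [state, sum_norm_sq_unitary_mulVec, sum_norm_sq_applyOracle, ih]

theorem acceptProb_le_one (A : QuantumQueryAlgorithm I Z W) (op : S → Equiv.Perm Z) (x : I → S) :
    A.acceptProb op x ≤ 1 := by
  rw [← A.sum_norm_sq_state op x A.queries, acceptProb]
  exact Finset.sum_le_sum_of_subset_of_nonneg (Finset.subset_univ _) fun _ _ _ => by positivity

end QuantumQueryAlgorithm

/-! ### Parity checks: independence of small sets and distance from satisfiability -/

/-- Averages of functions of degree at most `k` over all right hand sides, and over the right hand
sides of satisfiable systems, coincide if no nonempty set of at most `k` equations is dependent. -/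
theorem card_mul_sum_eq_of_lowDegree {M Y : Type} [Fintype M] [DecidableEq M] [Fintype Y]
    [DecidableEq Y] (A : (Y → ZMod 2) →+ (M → ZMod 2)) {k : ℕ}
    (hA : ∀ s : Finset M, s.Nonempty → s.card ≤ k → ∃ y, ∑ i ∈ s, A y i ≠ 0)
    {f : (M → ZMod 2) → ℂ} (hf : f ∈ lowDegree M k) :
    (Fintype.card (M → ZMod 2) : ℂ) * ∑ y, f (A y) =
      (Fintype.card (Y → ZMod 2) : ℂ) * ∑ b, f b := by
  have flip : ∀ c : ZMod 2, c ≠ 0 → bitSign c = -1 := fun c hc => by simp [bitSign, hc]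
  have pc : ∀ (s : Finset M) b, parityChar s b = bitSign (∑ i ∈ s, b i) :=
    fun s b => (bitSign_sum s b).symm
  have self_neg : ∀ z : ℂ, z = -z → z = 0 := fun z hz => by
    have : (2 : ℂ) * z = 0 := by linear_combination hz
    simpa using this
  induction hf using Submodule.span_induction with
  | mem x h =>
    obtain ⟨s, hs, rfl⟩ := h
    rcases s.eq_empty_or_nonempty with rfl | hne
    · simp only [parityChar, Finset.prod_empty, Finset.sum_const, Finset.card_univ, nsmul_eq_mul,
        mul_one]
      ring
    -- Translation by `y₀`, respectively by `A y₀`, flips the sign of a nontrivial character, so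
    -- both of its sums vanish.
    · obtain ⟨y₀, hy₀⟩ := hA s hne hs
      have e1 : ∑ y, parityChar s (A y) = 0 := by
        apply self_neg
        conv_lhs => rw [← Equiv.sum_comp (Equiv.addRight y₀)]
        rw [← Finset.sum_neg_distrib]
        refine Finset.sum_congr rfl fun y _ => ?_
        simp only [Equiv.coe_addRight, map_add, pc, Pi.add_apply, Finset.sum_add_distrib,
          bitSign_add, flip _ hy₀]
        ring
      have e2 : ∑ b, parityChar s b = 0 := by
        apply self_neg
        conv_lhs => rw [← Equiv.sum_comp (Equiv.addRight (A y₀))]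
        rw [← Finset.sum_neg_distrib]
        refine Finset.sum_congr rfl fun y _ => ?_
        simp only [Equiv.coe_addRight, pc, Pi.add_apply, Finset.sum_add_distrib,
          bitSign_add, flip _ hy₀]
        ring
      rw [e1, e2]; simp
  | zero => simp
  | add x y _ _ hx hy => simp only [Pi.add_apply, Finset.sum_add_distrib, mul_add, hx, hy]
  | smul a x _ hx =>
    simp only [Pi.smul_apply, smul_eq_mul, ← Finset.mul_sum]
    linear_combination a * hx

/-- A uniform permutation maps `s` to a uniform `k`-set. The pairs `(t, π)` for which the image of
the `k`-set `t` lies in `F` are counted in two ways; the count for fixed `t` does not depend on `t`.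
-/
theorem card_perm_map_mem_mul_choose {α : Type} [Fintype α] [DecidableEq α]
    {F : Finset (Finset α)} {k : ℕ} (hF : ∀ t ∈ F, t.card = k) {s : Finset α} (hs : s.card = k) :
    (Finset.univ.filter fun π : Equiv.Perm α => s.map π.toEmbedding ∈ F).card *
      (Fintype.card α).choose k = (Fintype.card α).factorial * F.card := by
  have outer : ∀ t ∈ Finset.powersetCard k (Finset.univ : Finset α),
      (Finset.univ.filter fun π : Equiv.Perm α => t.map π.toEmbedding ∈ F).card =
      (Finset.univ.filter fun π : Equiv.Perm α => s.map π.toEmbedding ∈ F).card := by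
    intro t ht
    rw [Finset.mem_powersetCard] at ht
    let e := (Finset.equivOfCardEq (ht.2.trans hs.symm)).extendSubtype
    have he : t.map e.toEmbedding = s := by
      apply Finset.eq_of_subset_of_card_le
      · intro a ha
        obtain ⟨b, hb, rfl⟩ := Finset.mem_map.1 ha
        simpa [e] using Equiv.extendSubtype_mem (Finset.equivOfCardEq (ht.2.trans hs.symm)) b hb
      · rw [Finset.card_map, ht.2, hs]
    symm
    apply Finset.card_bij (fun π _ => e.trans π)
    · intro π hπ
      simp only [Finset.mem_filter, Finset.mem_univ, true_and] at hπ ⊢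
      rw [← he, Finset.map_map] at hπ
      exact hπ
    · intro π _ π' _ h
      exact Equiv.ext fun a => by simpa using congrArg (fun f => f (e.symm a)) h
    · intro π hπ
      refine ⟨e.symm.trans π, ?_, by ext; simp⟩
      simp only [Finset.mem_filter, Finset.mem_univ, true_and] at hπ ⊢
      rw [← he, Finset.map_map]
      convert hπ using 2
      ext; simp
  have inner : ∀ π ∈ (Finset.univ : Finset (Equiv.Perm α)),
      ((Finset.powersetCard k (Finset.univ : Finset α)).filter
        fun t => t.map π.toEmbedding ∈ F).card = F.card := by
    intro π _
    apply Finset.card_bij (fun t _ => t.map π.toEmbedding)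
    · intro t ht
      exact (Finset.mem_filter.1 ht).2
    · intro t _ t' _ h
      exact Finset.map_injective _ h
    · intro t ht
      refine ⟨t.map π.symm.toEmbedding, ?_, ?_⟩
      · have : (t.map π.symm.toEmbedding).map π.toEmbedding = t := by
          rw [Finset.map_map]; ext; simp
        simp only [Finset.mem_filter, Finset.mem_powersetCard, Finset.subset_univ, true_and,
          Finset.card_map, this]
        exact ⟨hF t ht, ht⟩
      · rw [Finset.map_map]; ext; simp
  have dc := Finset.sum_card_bipartiteAbove_eq_sum_card_bipartiteBelow
    (s := Finset.powersetCard k (Finset.univ : Finset α)) (t := (Finset.univ : Finset (Equiv.Perm α)))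
    (fun t π => t.map π.toEmbedding ∈ F)
  simp only [Finset.bipartiteAbove, Finset.bipartiteBelow] at dc
  rw [Finset.sum_congr rfl outer, Finset.sum_congr rfl inner] at dc
  simp only [Finset.sum_const, Finset.card_powersetCard, Finset.card_univ, smul_eq_mul,
    Fintype.card_perm] at dc
  rw [mul_comm, dc]

theorem pow_le_choose_of_mul_le {a s : ℕ} : ∀ {n : ℕ}, a * s ≤ n → a ^ s ≤ n.choose s := by
  induction s with
  | zero => simp
  | succ s ih =>
    intro n h
    rcases Nat.eq_zero_or_pos a with rfl | ha
    · simp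
    obtain ⟨n, rfl⟩ : ∃ k, n = k + 1 :=
      ⟨n - 1, by have : 0 < a * (s + 1) := by positivity
                 omega⟩
    have h1 : a * s ≤ n := by nlinarith
    have h2 := ih h1
    have h3 := Nat.add_one_mul_choose_eq n s
    have h4 : (s + 1) * a ^ (s + 1) ≤ (s + 1) * (n + 1).choose (s + 1) := by
      calc (s + 1) * a ^ (s + 1) = (a * (s + 1)) * a ^ s := by ring
        _ ≤ (n + 1) * n.choose s := Nat.mul_le_mul h h2
        _ = (s + 1) * (n + 1).choose (s + 1) := by rw [h3]; ring
    exact Nat.le_of_mul_le_mul_left h4 (Nat.succ_pos s)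

theorem choose_sq_le_choose_two_mul (q r : ℕ) : q.choose r ^ 2 ≤ (2 * q).choose (2 * r) := by
  rw [two_mul, two_mul, Nat.add_choose_eq, sq]
  exact Finset.single_le_sum (f := fun ij : ℕ × ℕ => q.choose ij.1 * q.choose ij.2)
    (fun _ _ => Nat.zero_le _) (a := (r, r)) (by simp)

/-- The sets of size `2 * r` that meet every fibre of the projection to `Fin q` evenly. -/
def evenSets (q D r : ℕ) : Finset (Finset (Fin q × Fin D)) :=
  (Finset.powersetCard (2 * r) Finset.univ).filter
    fun t => ∀ f, Even (t.filter fun a => a.1 = f).card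

/-- Each fibre that is met contains at least two points, so the projection has at most `r` elements
and the set lies over some `r`-subset of `Fin q`. -/
theorem card_evenSets_le {q r : ℕ} (D : ℕ) (hr : r ≤ q) :
    (evenSets q D r).card ≤ q.choose r * 2 ^ (D * r) := by
  have hsub : evenSets q D r ⊆ (Finset.powersetCard r Finset.univ).biUnion
      fun Q : Finset (Fin q) => (Q ×ˢ (Finset.univ : Finset (Fin D))).powerset := by
    intro t ht
    simp only [evenSets, Finset.mem_filter, Finset.mem_powersetCard] at ht
    obtain ⟨⟨-, htc⟩, hev⟩ := ht
    have h2 : 2 * (t.image Prod.fst).card ≤ t.card := by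
      rw [Finset.card_eq_sum_card_image Prod.fst t, mul_comm, ← smul_eq_mul]
      apply Finset.card_nsmul_le_sum
      intro f hf
      obtain ⟨a, ha, rfl⟩ := Finset.mem_image.1 hf
      have hpos : 0 < (t.filter fun b => b.1 = a.1).card :=
        Finset.card_pos.2 ⟨a, Finset.mem_filter.2 ⟨ha, rfl⟩⟩
      obtain ⟨k, hk⟩ := hev a.1
      omega
    obtain ⟨Q, hQ, hQc⟩ := Finset.exists_superset_card_eq (s := t.image Prod.fst) (n := r)
      (by omega) (by simpa using hr)
    refine Finset.mem_biUnion.2 ⟨Q, by simp [Finset.mem_powersetCard, hQc], ?_⟩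
    rw [Finset.mem_powerset]
    intro a ha
    simpa using hQ (Finset.mem_image_of_mem _ ha)
  refine (Finset.card_le_card hsub).trans ?_
  have := Finset.card_biUnion_le_card_mul (Finset.powersetCard r (Finset.univ : Finset (Fin q)))
    (fun Q : Finset (Fin q) => (Q ×ˢ (Finset.univ : Finset (Fin D))).powerset) (2 ^ (D * r)) (by
      intro Q hQ
      rw [Finset.card_powerset, Finset.card_product, (Finset.mem_powersetCard.1 hQ).2]
      simp [mul_comm])
  simpa using this

/-- With `F` and `C` the numbers of even sets and of all sets of size `2 * r`, the expected number
of sets that are even under four independent permutations is `C * (F / C) ^ 4`. The bound says that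
this is at most `2 ^ (-r)`. -/
theorem card_evenSets_pow_le {q r : ℕ} (hr : r * 2 ^ 30 ≤ q) :
    (evenSets q 16 r).card ^ 4 * 2 ^ r ≤ (16 * q).choose (2 * r) ^ 3 := by
  have h1 := card_evenSets_le (q := q) (r := r) 16 (by omega)
  have h2 : q.choose r ^ 2 ≤ (16 * q).choose (2 * r) :=
    (choose_sq_le_choose_two_mul q r).trans (Nat.choose_le_choose _ (by omega))
  -- The exponent 65 is `4 * 16 + 1`: the fourth power of `2 ^ (16 * r)` and the extra factor `2 ^
  -- r`.
  have h3 : 2 ^ (65 * r) ≤ (16 * q).choose (2 * r) := by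
    have := pow_le_choose_of_mul_le (a := 2 ^ 33) (s := 2 * r) (n := 16 * q) (by omega)
    refine le_trans ?_ this
    rw [← pow_mul]
    exact Nat.pow_le_pow_right (by norm_num) (by omega)
  calc (evenSets q 16 r).card ^ 4 * 2 ^ r ≤ (q.choose r * 2 ^ (16 * r)) ^ 4 * 2 ^ r :=
        Nat.mul_le_mul_right _ (Nat.pow_le_pow_left h1 4)
    _ = (q.choose r ^ 2) ^ 2 * 2 ^ (65 * r) := by
        rw [mul_pow, ← pow_mul, ← pow_mul, mul_assoc, ← pow_add]
        congr 2; ring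
    _ ≤ (16 * q).choose (2 * r) ^ 2 * (16 * q).choose (2 * r) :=
        Nat.mul_le_mul (Nat.pow_le_pow_left h2 2) h3
    _ = _ := by ring

/-- A sparse system of parity checks in which small sets of equations are independent: the `j`-th
variable of the equation `i` is `(π j i).1`. -/
theorem exists_perms_odd_fiber {J : Type} [Fintype J] [DecidableEq J] (hJ : Fintype.card J = 4)
    {q R : ℕ} (hR : R * 2 ^ 30 ≤ q) :
    ∃ π : J → Equiv.Perm (Fin q × Fin 16), ∀ s : Finset (Fin q × Fin 16), s.Nonempty →
      s.card ≤ 2 * R → ∃ j f, Odd (s.filter fun i => (π j i).1 = f).card := by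
  by_contra hcon
  push Not at hcon
  have hm : Fintype.card (Fin q × Fin 16) = 16 * q := by simp [mul_comm]
  set m := Fintype.card (Fin q × Fin 16) with hmdef
  let X : Finset (Fin q × Fin 16) → ℕ → Finset (Equiv.Perm (Fin q × Fin 16)) := fun s r =>
    Finset.univ.filter fun π => s.map π.toEmbedding ∈ evenSets q 16 r
  -- Variables at different positions `j` are distinct, so a dependent set is even under each `π j`
  -- separately. This makes the bad tuples for a given `s` a product set.
  have cover : (Finset.univ : Finset (J → Equiv.Perm (Fin q × Fin 16))) ⊆
      (Finset.range R).biUnion fun r => (Finset.powersetCard (2 * (r + 1)) Finset.univ).biUnion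
        fun s => Fintype.piFinset fun _ => X s (r + 1) := by
    intro π _
    obtain ⟨s, hne, hsc, hev⟩ := hcon π
    simp only [Nat.not_odd_iff_even] at hev
    have hev' : ∀ j f, Even ((s.map (π j).toEmbedding).filter fun a => a.1 = f).card := by
      intro j f
      rw [Finset.filter_map, Finset.card_map]
      exact hev j f
    obtain ⟨j₀⟩ : Nonempty J := Fintype.card_pos_iff.1 (by omega)
    -- A dependent set is partitioned into even fibres, so only sizes `2 * (r + 1)` occur.
    have hse : Even s.card := by
      rw [Finset.card_eq_sum_card_fiberwise (f := fun i => (π j₀ i).1) (t := Finset.univ)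
        (by simp [Set.MapsTo])]
      exact Finset.even_sum _ fun f _ => hev j₀ f
    obtain ⟨r, hr⟩ := hse
    have hpos := hne.card_pos
    obtain ⟨r, rfl⟩ : ∃ k, r = k + 1 := ⟨r - 1, by omega⟩
    refine Finset.mem_biUnion.2 ⟨r, by simp; omega, Finset.mem_biUnion.2 ⟨s, ?_, ?_⟩⟩
    · simp only [Finset.mem_powersetCard, Finset.subset_univ, true_and]; omega
    · simp only [Fintype.mem_piFinset, X, Finset.mem_filter, Finset.mem_univ, true_and, evenSets,
        Finset.mem_powersetCard, Finset.subset_univ, Finset.card_map]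
      exact fun j => ⟨by omega, hev' j⟩
  have bound : ∀ r < R, ∀ s ∈ Finset.powersetCard (2 * (r + 1))
      (Finset.univ : Finset (Fin q × Fin 16)),
      m.choose (2 * (r + 1)) * (X s (r + 1)).card ^ 4 * 2 ^ (r + 1) ≤ m.factorial ^ 4 := by
    intro r hr s hs
    have h1 := card_perm_map_mem_mul_choose (F := evenSets q 16 (r + 1)) (k := 2 * (r + 1))
      (fun t ht => (Finset.mem_powersetCard.1 (Finset.mem_filter.1 ht).1).2)
      (Finset.mem_powersetCard.1 hs).2
    rw [← hmdef] at h1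
    change (X s (r + 1)).card * _ = _ at h1
    have h2 := card_evenSets_pow_le (q := q) (r := r + 1)
      ((Nat.mul_le_mul_right _ hr).trans hR)
    rw [← hm] at h2
    have hCpos : 0 < m.choose (2 * (r + 1)) := Nat.choose_pos (by
      rw [← (Finset.mem_powersetCard.1 hs).2]; exact Finset.card_le_univ s)
    generalize m.choose (2 * (r + 1)) = C at *
    generalize (X s (r + 1)).card = x at *
    generalize (evenSets q 16 (r + 1)).card = F at *
    refine Nat.le_of_mul_le_mul_left ?_ (pow_pos hCpos 3)
    calc C ^ 3 * (C * x ^ 4 * 2 ^ (r + 1)) = (x * C) ^ 4 * 2 ^ (r + 1) := by ring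
      _ = m.factorial ^ 4 * (F ^ 4 * 2 ^ (r + 1)) := by rw [h1]; ring
      _ ≤ m.factorial ^ 4 * C ^ 3 := Nat.mul_le_mul_left _ h2
      _ = _ := by ring
  have bound2 : ∀ r < R, (((Finset.powersetCard (2 * (r + 1))
      (Finset.univ : Finset (Fin q × Fin 16))).biUnion
        fun s => Fintype.piFinset fun _ : J => X s (r + 1)).card : ℚ) ≤
      (m.factorial : ℚ) ^ 4 * (1 / 2) ^ (r + 1) := by
    intro r hr
    have h1 : (((Finset.powersetCard (2 * (r + 1))
      (Finset.univ : Finset (Fin q × Fin 16))).biUnion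
        fun s => Fintype.piFinset fun _ : J => X s (r + 1)).card : ℚ) ≤
        ∑ s ∈ Finset.powersetCard (2 * (r + 1)) (Finset.univ : Finset (Fin q × Fin 16)),
          ((X s (r + 1)).card : ℚ) ^ 4 := by
      refine (Nat.cast_le.2 Finset.card_biUnion_le).trans ?_
      push_cast
      refine Finset.sum_le_sum fun s _ => ?_
      rw [Fintype.card_piFinset, Finset.prod_const, Finset.card_univ, hJ, Nat.cast_pow]
    refine h1.trans ?_
    rcases (Finset.powersetCard (2 * (r + 1))
      (Finset.univ : Finset (Fin q × Fin 16))).eq_empty_or_nonempty with he | hne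
    · rw [he]; simp only [Finset.sum_empty]; positivity
    have hC : (0 : ℚ) < m.choose (2 * (r + 1)) := by
      have := hne.card_pos
      rw [Finset.card_powersetCard, Finset.card_univ] at this
      exact_mod_cast this
    refine (Finset.sum_le_card_nsmul _ _
      ((m.factorial : ℚ) ^ 4 * (1 / 2) ^ (r + 1) / m.choose (2 * (r + 1))) ?_).trans ?_
    · intro s hs
      rw [le_div_iff₀ hC, one_div, inv_pow, ← div_eq_mul_inv, le_div_iff₀ (by positivity)]
      have := bound r hr s hs
      have h : ((m.choose (2 * (r + 1)) * (X s (r + 1)).card ^ 4 * 2 ^ (r + 1) : ℕ) : ℚ) ≤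
        ((m.factorial ^ 4 : ℕ) : ℚ) := Nat.cast_le.2 this
      push_cast at h
      linarith
    · rw [Finset.card_powersetCard, Finset.card_univ, nsmul_eq_mul, ← hmdef]
      exact le_of_eq (mul_div_cancel₀ _ hC.ne')
  have total : ((m.factorial : ℚ)) ^ 4 ≤
      ∑ r ∈ Finset.range R, (m.factorial : ℚ) ^ 4 * (1 / 2) ^ (r + 1) := by
    have h := Finset.card_le_card cover
    rw [Finset.card_univ, Fintype.card_fun, hJ, Fintype.card_perm, ← hmdef] at h
    have h' := h.trans Finset.card_biUnion_le
    calc ((m.factorial : ℚ)) ^ 4 = ((m.factorial ^ 4 : ℕ) : ℚ) := by push_cast; rfl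
      _ ≤ _ := Nat.cast_le.2 h'
      _ ≤ _ := by
        push_cast
        exact Finset.sum_le_sum fun r hr => bound2 r (Finset.mem_range.1 hr)
  -- The failure probabilities `2 ^ (-(r + 1))` sum to less than 1.
  have geom : ∀ n : ℕ, ∑ r ∈ Finset.range n, (1 / 2 : ℚ) ^ (r + 1) < 1 := by
    intro n
    have : ∑ r ∈ Finset.range n, (1 / 2 : ℚ) ^ (r + 1) = 1 - (1 / 2) ^ n := by
      induction n with
      | zero => simp
      | succ n ih => rw [Finset.sum_range_succ, ih]; ring
    rw [this]
    have : (0 : ℚ) < (1 / 2) ^ n := by positivity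
    linarith
  rw [← Finset.mul_sum] at total
  have hpos : (0 : ℚ) < (m.factorial : ℚ) ^ 4 := by
    have := Nat.factorial_pos m
    positivity
  nlinarith [geom R]

/-- Most right hand sides are far from those of satisfiable systems. -/
theorem four_mul_card_near_le {M Y : Type} [Fintype M] [DecidableEq M] [Fintype Y]
    [DecidableEq Y] {q : ℕ} (hq : 1 ≤ q) (hM : Fintype.card M = 16 * q)
    (hY : Fintype.card Y = 4 * q) (A : (Y → ZMod 2) → (M → ZMod 2)) :
    4 * (Finset.univ.filter fun b : M → ZMod 2 =>
      ∃ y, (Finset.univ.filter fun i => A y i ≠ b i).card ≤ q).card ≤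
      Fintype.card (M → ZMod 2) := by
  set near := Finset.univ.filter fun b : M → ZMod 2 =>
      ∃ y, (Finset.univ.filter fun i => A y i ≠ b i).card ≤ q
  set vol := (Finset.univ : Finset (Finset M)).filter fun s => s.card ≤ q
  have h1 : near.card ≤ 2 ^ (4 * q) * vol.card := by
    -- A near right hand side is given by an assignment and the set of at most `q` checks that it
    -- violates.
    have hsub : near ⊆ ((Finset.univ : Finset (Y → ZMod 2)) ×ˢ vol).image
        fun p => fun i => A p.1 i + if i ∈ p.2 then 1 else 0 := by
      intro b hb
      obtain ⟨y, hy⟩ := (Finset.mem_filter.1 hb).2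
      refine Finset.mem_image.2 ⟨(y, Finset.univ.filter fun i => A y i ≠ b i), ?_, ?_⟩
      · simpa [vol] using hy
      · funext i
        have hz : ∀ a c : ZMod 2, a ≠ c → a + 1 = c := by decide
        by_cases h : A y i = b i
        · simp [h]
        · simp [h, hz _ _ h]
    refine (Finset.card_le_card hsub).trans (Finset.card_image_le.trans ?_)
    simp [Finset.card_product, hY]
  -- In the expansion of `(1 + 4) ^ (16 * q)` every set of size at most `q` has weight at least `4 ^
  -- (15 * q)`.
  have h2 : vol.card * 4 ^ (15 * q) ≤ 5 ^ (16 * q) := by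
    have hsum := Finset.sum_pow_mul_eq_add_pow (1 : ℕ) 4 (Finset.univ : Finset M)
    rw [Finset.card_univ, hM] at hsum
    norm_num at hsum
    rw [← hsum, ← smul_eq_mul]
    refine (Finset.card_nsmul_le_sum vol (fun t => 4 ^ (16 * q - t.card)) _ ?_).trans ?_
    · intro t ht
      have := (Finset.mem_filter.1 ht).2
      exact Nat.pow_le_pow_right (by norm_num) (by omega)
    · exact Finset.sum_le_sum_of_subset (Finset.subset_univ _)
  rw [Fintype.card_fun, hM, ZMod.card]
  refine Nat.le_of_mul_le_mul_right (c := 4 ^ (15 * q)) ?_ (by positivity)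
  calc 4 * near.card * 4 ^ (15 * q) ≤ 4 * (2 ^ (4 * q) * vol.card) * 4 ^ (15 * q) := by gcongr
    _ = 4 * 2 ^ (4 * q) * (vol.card * 4 ^ (15 * q)) := by ring
    _ ≤ 4 * 2 ^ (4 * q) * 5 ^ (16 * q) := by gcongr
    _ ≤ 4 ^ q * 2 ^ (4 * q) * 5 ^ (16 * q) := by
        gcongr
        exact Nat.le_self_pow (by omega) 4
    _ = (4 * 2 ^ 4 * 5 ^ 16) ^ q := by rw [mul_pow, mul_pow, ← pow_mul, ← pow_mul]
    _ ≤ (2 ^ 16 * 4 ^ 15) ^ q := Nat.pow_le_pow_left (by norm_num) q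
    _ = 2 ^ (16 * q) * 4 ^ (15 * q) := by rw [mul_pow, ← pow_mul, ← pow_mul]

/-! ### Chains of blocks that copy a color with degree at most 4 -/

section Chain

variable {X P : Type}

/-- Every vertex `x` of a graph whose edges are given by a partial matching `partner` of the ports
`(x, p)` is replaced by a cyclic chain of blocks with seven vertices, one block for each port. In
every proper `3`-coloring, the vertices `0`, `3`, `6` of all blocks of a chain have the same color;
the vertex `6` of a block carries the edge at its port. -/
def chainNeighbors (nxt : Equiv.Perm P) (partner : X × P → Option (X × P))
    (v : (X × P) × Fin 7) : List ((X × P) × Fin 7) :=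
  match v with
  | (a, 0) => [(a, 1), (a, 2), ((a.1, nxt.symm a.2), 4), ((a.1, nxt.symm a.2), 5)]
  | (a, 1) => [(a, 0), (a, 2), (a, 3), (a, 4)]
  | (a, 2) => [(a, 0), (a, 1), (a, 3), (a, 6)]
  | (a, 3) => [(a, 1), (a, 2), (a, 4), (a, 5)]
  | (a, 4) => [(a, 1), (a, 3), (a, 5), ((a.1, nxt a.2), 0)]
  | (a, 5) => [(a, 3), (a, 4), (a, 6), ((a.1, nxt a.2), 0)]
  | (a, 6) => (a, 2) :: (a, 5) :: ((partner a).map fun b => (b, 6)).toList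

variable {nxt : Equiv.Perm P} {partner : X × P → Option (X × P)}

theorem mem_chainNeighbors_symm (hsymm : ∀ a b, partner a = some b → partner b = some a)
    {v w : (X × P) × Fin 7} (h : w ∈ chainNeighbors nxt partner v) :
    v ∈ chainNeighbors nxt partner w := by
  obtain ⟨a, k⟩ := v
  fin_cases k <;> simp only [chainNeighbors, List.mem_cons, List.not_mem_nil, or_false,
    Option.mem_toList, Option.mem_def, Option.map_eq_some_iff, Fin.zero_eta, Fin.mk_one,
    Fin.reduceFinMk] at h
  on_goal 7 =>
    rcases h with rfl | rfl | ⟨b, hb, rfl⟩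
    · simp [chainNeighbors]
    · simp [chainNeighbors]
    · simp [chainNeighbors, hsymm _ _ hb]
  all_goals rcases h with rfl | rfl | rfl | rfl <;> simp [chainNeighbors]

theorem not_mem_chainNeighbors_self (hirr : ∀ a, partner a ≠ some a) (v : (X × P) × Fin 7) :
    v ∉ chainNeighbors nxt partner v := by
  obtain ⟨a, k⟩ := v
  fin_cases k <;> simp [chainNeighbors, hirr]

theorem nodup_chainNeighbors (v : (X × P) × Fin 7) :
    (chainNeighbors nxt partner v).Nodup := by
  obtain ⟨a, k⟩ := v
  fin_cases k
  on_goal 7 =>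
    simp only [chainNeighbors]
    cases partner a <;> simp
  all_goals simp [chainNeighbors]

theorem length_chainNeighbors_le (v : (X × P) × Fin 7) :
    (chainNeighbors nxt partner v).length ≤ 4 := by
  obtain ⟨a, k⟩ := v
  fin_cases k
  on_goal 7 =>
    simp only [chainNeighbors]
    cases partner a <;> simp
  all_goals simp [chainNeighbors]

theorem chainNeighbors_congr {partner' : X × P → Option (X × P)} {v : (X × P) × Fin 7}
    (h : partner v.1 = partner' v.1) :
    chainNeighbors nxt partner v = chainNeighbors nxt partner' v := by
  obtain ⟨a, k⟩ := v
  fin_cases k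
  on_goal 7 => simp only [chainNeighbors]; rw [show partner a = partner' a from h]
  all_goals rfl

/-- The extension to chains of a coloring of the vertices. -/
def chainColor (c : X → Fin 3) (v : (X × P) × Fin 7) : Fin 3 :=
  c v.1.1 + (![0, 1, 2, 0, 2, 1, 0] : Fin 7 → Fin 3) v.2

theorem chainColor_ne {c : X → Fin 3} (hc : ∀ a b, partner a = some b → c a.1 ≠ c b.1)
    {v w : (X × P) × Fin 7} (h : w ∈ chainNeighbors nxt partner v) :
    chainColor c v ≠ chainColor c w := by
  obtain ⟨a, k⟩ := v
  fin_cases k <;> simp only [chainNeighbors, List.mem_cons, List.not_mem_nil, or_false,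
    Option.mem_toList, Option.mem_def, Option.map_eq_some_iff, Fin.zero_eta, Fin.mk_one,
    Fin.reduceFinMk] at h
  on_goal 7 =>
    rcases h with rfl | rfl | ⟨b, hb, rfl⟩
    · simp [chainColor]
    · simp [chainColor]
    · simpa [chainColor] using hc _ _ hb
  all_goals rcases h with rfl | rfl | rfl | rfl <;> simp [chainColor]

/-- The triangles 0,1,2 and 1,2,3 give 3 the color of 0. The edge 1–4 then forces 4 to repeat the
color of 2, and 5 that of 1, so 6, adjacent to 2 and 5, has the color of 0. The next 0, adjacent to
4 and 5, has it too. Since `nxt` has a single cycle, the color spreads to all ports. -/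
theorem chain_color_eq {C : (X × P) × Fin 7 → Fin 3} {x : X}
    (hnxt : ∀ p p', nxt.SameCycle p p')
    (hC : ∀ p k, ∀ w ∈ chainNeighbors nxt partner ((x, p), k), C ((x, p), k) ≠ C w) (p p' : P) :
    C ((x, p), 6) = C ((x, p'), 0) := by
  have block : ∀ u a b u' a' b' w u'' : Fin 3, u ≠ a → u ≠ b → a ≠ b → a ≠ u' → b ≠ u' →
      u' = u ∧ (a ≠ a' → b ≠ w → u' ≠ a' → u' ≠ b' → a' ≠ b' → a' ≠ u'' → b' ≠ u'' → b' ≠ w →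
        w = u ∧ u'' = u) := by
    intro u a b u' a' b' w u''
    omega
  have key : ∀ p, C ((x, p), 6) = C ((x, p), 0) ∧ C ((x, nxt p), 0) = C ((x, p), 0) := by
    intro p
    have h := block (C ((x, p), 0)) (C ((x, p), 1)) (C ((x, p), 2)) (C ((x, p), 3)) (C ((x, p), 4))
      (C ((x, p), 5)) (C ((x, p), 6)) (C ((x, nxt p), 0))
      (hC p 0 _ (by simp [chainNeighbors])) (hC p 0 _ (by simp [chainNeighbors]))
      (hC p 1 _ (by simp [chainNeighbors])) (hC p 1 _ (by simp [chainNeighbors]))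
      (hC p 2 _ (by simp [chainNeighbors]))
    exact h.2 (hC p 1 _ (by simp [chainNeighbors])) (hC p 2 _ (by simp [chainNeighbors]))
      (hC p 3 _ (by simp [chainNeighbors])) (hC p 3 _ (by simp [chainNeighbors]))
      (hC p 4 _ (by simp [chainNeighbors])) (hC p 4 _ (by simp [chainNeighbors]))
      (hC p 5 _ (by simp [chainNeighbors])) (hC p 5 _ (by simp [chainNeighbors]))
  rw [(key p).1]
  obtain ⟨n, hn⟩ := (hnxt p p').symm
  have pow : ∀ (n : ℤ) p, C ((x, (nxt ^ n) p), 0) = C ((x, p), 0) := by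
    intro n
    induction n using Int.induction_on with
    | zero => simp
    | succ n ih =>
      intro p
      rw [add_comm, zpow_add, zpow_one, Equiv.Perm.mul_apply, (key _).2, ih]
    | pred n ih =>
      intro p
      rw [sub_eq_add_neg, add_comm, zpow_add, zpow_neg_one, Equiv.Perm.mul_apply, ← ih p,
        ← (key (nxt⁻¹ ((nxt ^ (-(n : ℤ))) p))).2]
      simp
  rw [← hn, pow n p']

end Chain

/-! ### The gadget of a single parity check -/

section Gadget

/-- The vertices of the gadget of a parity check: the cells `(square, row, column)` of two `3 × 3`
rook graphs, two triangles that enforce the parity, and a pair of vertices that enforces equal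
colors of the corner cells of the two squares. -/
abbrev Site := (Bool × Fin 3 × Fin 3) ⊕ (Bool × Fin 3) ⊕ Bool

/-- Adjacency between the vertex `t` of the triangle `k` and a cell, for the right hand side `β`. -/
def cornerAdj (β : ZMod 2) (k : Bool) (t : Fin 3) (s : Bool) (r c : Fin 3) : Bool :=
  match t with
  | 0 => s = false && r = 0 && c = 0
  | 1 => s = false && r = 1 && c = if k then 2 else 1
  | 2 => s = true && r = 1 && c = if Bool.xor k (β = 1) then 1 else 2

/-- The gadget of a parity check with right hand side `β`. -/
def siteAdj (β : ZMod 2) : Site → Site → Bool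
  | .inl (s, r, c), .inl (s', r', c') =>
    s = s' && ((r = r' && c ≠ c') || (r ≠ r' && c = c'))
  | .inl (s, r, c), .inr (.inl (k, t)) => cornerAdj β k t s r c
  | .inr (.inl (k, t)), .inl (s, r, c) => cornerAdj β k t s r c
  | .inr (.inl (k, t)), .inr (.inl (k', t')) => k = k' && t ≠ t'
  | .inl (_, r, c), .inr (.inr _) => r = 0 && c = 0
  | .inr (.inr _), .inl (_, r, c) => r = 0 && c = 0
  | .inr (.inr e), .inr (.inr e') => e ≠ e'
  | _, _ => false

theorem siteAdj_symm (β : ZMod 2) (γ γ' : Site) : siteAdj β γ γ' = siteAdj β γ' γ := by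
  rcases γ with ⟨s, r, c⟩ | ⟨k, t⟩ | e <;> rcases γ' with ⟨s', r', c'⟩ | ⟨k', t'⟩ | e' <;>
    simp only [siteAdj, ne_eq, eq_comm]

theorem siteAdj_irrefl (β : ZMod 2) (γ : Site) : siteAdj β γ γ = false := by
  rcases γ with ⟨s, r, c⟩ | ⟨k, t⟩ | e <;> simp [siteAdj]

/-- The square of a cell. -/
def siteSquare : Site → Bool
  | .inl (s, _, _) => s
  | .inr _ => false

/-- The ends of the links between the gadgets of different parity checks with a common variable:
the row (or, if `col` holds, the column) `0` of one is linked to the row (column) `1` of the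
other. -/
def linkSite (col out : Bool) : Site → Option Site
  | .inl (s, r, c) =>
    if col then
      if c = (if out then 0 else 1) then some (.inl (s, r, if out then 1 else 0)) else none
    else
      if r = (if out then 0 else 1) then some (.inl (s, if out then 1 else 0, c)) else none
  | .inr _ => none

theorem linkSite_symm {col out : Bool} {γ γ' : Site} (h : linkSite col out γ = some γ') :
    linkSite col (!out) γ' = some γ ∧ siteSquare γ' = siteSquare γ := by
  rcases γ with ⟨s, r, c⟩ | γ
  · cases col <;> cases out <;> simp only [linkSite, Bool.false_eq_true, if_true, if_false,
      Option.ite_none_right_eq_some, Option.some.injEq] at h <;> obtain ⟨rfl, rfl⟩ := h <;>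
      simp [linkSite, siteSquare]
  · simp [linkSite] at h

/-- The bits as nonzero elements of `Fin 3`. -/
def bitUnit (a : ZMod 2) : Fin 3 := if a = 0 then 1 else 2

/-- A coloring of the gadget, for the values `t` of the variables. -/
def siteColor (t : Bool × Bool → ZMod 2) : Site → Fin 3
  | .inl (s, r, c) => bitUnit (t (s, true)) * r + bitUnit (t (s, false)) * c
  | .inr (.inl (k, u)) =>
    if bitUnit (t (false, true)) + bitUnit (t (false, false)) * (if k then 2 else 1) = 0 then
      (![1, 2, 0] : Fin 3 → Fin 3) u else (![1, 0, 2] : Fin 3 → Fin 3) u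
  | .inr (.inr e) => if e then 1 else 2

/-- The corner cells have color 0. When the parity is right, exactly one of the two other cells
attached to a triangle has color 0 as well, and the vertex of the triangle attached to the remaining
one can take color 0. -/
theorem siteColor_cell_ne_triangle (t : Bool × Bool → ZMod 2) {k : Bool} {u : Fin 3} {s : Bool}
    {r c : Fin 3} (h : cornerAdj (∑ j, t j) k u s r c = true) :
    siteColor t (.inl (s, r, c)) ≠ siteColor t (.inr (.inl (k, u))) := by
  rw [Fintype.sum_prod_type, Fintype.sum_bool, Fintype.sum_bool, Fintype.sum_bool] at h
  simp only [siteColor]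
  fin_cases u <;> simp only [cornerAdj, Bool.and_eq_true, decide_eq_true_eq] at h <;>
    obtain ⟨⟨rfl, rfl⟩, rfl⟩ := h <;> generalize t (true, true) = a1, t (true, false) = a2,
    t (false, true) = a3, t (false, false) = a4 at *
  · revert k a3 a4; decide
  · revert k a3 a4; decide
  · revert k a1 a2 a3 a4; decide

theorem siteColor_ne (t : Bool × Bool → ZMod 2) {γ γ' : Site}
    (h : siteAdj (∑ j, t j) γ γ' = true) : siteColor t γ ≠ siteColor t γ' := by
  have cell : ∀ a b, ∀ r c r' c' : Fin 3, (r = r' ∧ c ≠ c') ∨ (r ≠ r' ∧ c = c') →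
      bitUnit a * r + bitUnit b * c ≠ bitUnit a * r' + bitUnit b * c' := by
    decide
  rcases γ with ⟨s, r, c⟩ | ⟨k, u⟩ | e <;> rcases γ' with ⟨s', r', c'⟩ | ⟨k', u'⟩ | e'
  · simp only [siteAdj, Bool.and_eq_true, Bool.or_eq_true, decide_eq_true_eq] at h
    obtain ⟨rfl, h⟩ := h
    exact cell _ _ _ _ _ _ h
  · exact siteColor_cell_ne_triangle t h
  · simp only [siteAdj, Bool.and_eq_true, decide_eq_true_eq] at h
    obtain ⟨rfl, rfl⟩ := h
    cases e' <;> simp [siteColor]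
  · exact (siteColor_cell_ne_triangle t h).symm
  · simp only [siteAdj, Bool.and_eq_true, decide_eq_true_eq] at h
    obtain ⟨rfl, h⟩ := h
    have tri : ∀ u u' : Fin 3, u ≠ u' → (![1, 2, 0] : Fin 3 → Fin 3) u ≠ ![1, 2, 0] u' ∧
      (![1, 0, 2] : Fin 3 → Fin 3) u ≠ ![1, 0, 2] u' := by decide
    simp only [siteColor]
    split_ifs <;> first | exact (tri u u' h).1 | exact (tri u u' h).2
  · simp [siteAdj] at h
  · simp only [siteAdj, Bool.and_eq_true, decide_eq_true_eq] at h
    obtain ⟨rfl, rfl⟩ := h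
    cases e <;> simp [siteColor]
  · simp [siteAdj] at h
  · simp only [siteAdj, decide_eq_true_eq] at h
    cases e <;> cases e' <;> simp [siteColor] at h ⊢

theorem siteColor_link_ne {t t' : Bool × Bool → ZMod 2} {col : Bool} {γ γ' : Site}
    (h : linkSite col true γ = some γ')
    (ht : t (siteSquare γ, col) = t' (siteSquare γ, col)) : siteColor t γ ≠ siteColor t' γ' := by
  have hu : ∀ a, bitUnit a ≠ 0 := by decide
  rcases γ with ⟨s, r, c⟩ | γ
  · cases col <;> simp only [linkSite, Bool.false_eq_true, if_true, if_false,
      Option.ite_none_right_eq_some, Option.some.injEq] at h <;> obtain ⟨rfl, rfl⟩ := h <;>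
      simp only [siteSquare] at ht <;> simp [siteColor, ht, hu]
  · simp [linkSite] at h

/-- The bit encoded by the colors of two cells of a row or column. -/
def pairSign (x y : Fin 3) : ZMod 2 := if x + 1 = y then 0 else 1

/-- The values of the variables read off a coloring of the gadget. -/
def siteSign (c : Site → Fin 3) (j : Bool × Bool) : ZMod 2 :=
  pairSign (c (.inl (j.1, 0, 0))) (c (if j.2 then .inl (j.1, 1, 0) else .inl (j.1, 0, 1)))

/-- Two permutations of three colors that differ in every place differ by a cyclic shift, so they
have the same orientation. -/
theorem pairSign_eq_of_prism : ∀ x₀ x₁ x₂ : Fin 3, x₀ ≠ x₁ ∧ x₀ ≠ x₂ ∧ x₁ ≠ x₂ →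
    ∀ y₀ y₁ y₂, y₀ ≠ y₁ ∧ y₀ ≠ y₂ ∧ y₁ ≠ y₂ → x₀ ≠ y₀ ∧ x₁ ≠ y₁ ∧ x₂ ≠ y₂ →
    pairSign x₀ x₁ = pairSign y₀ y₁ := by
  decide

/-- A Latin square of order 3 has the form `u * r + v * c + const` with `u`, `v` nonzero modulo 3.
The corner color recurs in row 1 at column 2 if `u = v`, and at column 1 if `u = -v`. -/
theorem diagonal_eq_of_rook {L : Fin 3 → Fin 3 → Fin 3}
    (hrow : ∀ r c c', c ≠ c' → L r c ≠ L r c') (hcol : ∀ r r' c, r ≠ r' → L r c ≠ L r' c) :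
    L 1 (if pairSign (L 0 0) (L 1 0) = pairSign (L 0 0) (L 0 1) then 2 else 1) = L 0 0 := by
  have h := fun r => (⟨hrow r 0 1 (by decide), hrow r 0 2 (by decide), hrow r 1 2 (by decide)⟩ :
    L r 0 ≠ L r 1 ∧ L r 0 ≠ L r 2 ∧ L r 1 ≠ L r 2)
  have h' := fun c => (⟨hcol 0 1 c (by decide), hcol 0 2 c (by decide), hcol 1 2 c (by decide)⟩ :
    L 0 c ≠ L 1 c ∧ L 0 c ≠ L 2 c ∧ L 1 c ≠ L 2 c)
  have key : ∀ a00 a01 : Fin 3, a00 ≠ a01 → ∀ a02, a00 ≠ a02 ∧ a01 ≠ a02 → ∀ a10, a00 ≠ a10 →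
      ∀ a11, a10 ≠ a11 ∧ a01 ≠ a11 → ∀ a12, a10 ≠ a12 ∧ a11 ≠ a12 ∧ a02 ≠ a12 →
      (if pairSign a00 a10 = pairSign a00 a01 then a12 else a11) = a00 := by decide
  have := key _ _ (h 0).1 _ (h 0).2 _ (h' 0).1 _ ⟨(h 1).1, (h' 1).1⟩ _
    ⟨(h 1).2.1, (h 1).2.2, (h' 2).1⟩
  split_ifs at this ⊢ <;> exact this

/-- By `diagonal_eq_of_rook`, the place where a corner color recurs in row 1 records the sum of the
two bits of a square. Each of the two triangles excludes one combination of these sums, which leaves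
those with total `β`. -/
theorem sum_siteSign {β : ZMod 2} {c : Site → Fin 3}
    (hc : ∀ γ γ', siteAdj β γ γ' = true → c γ ≠ c γ') : ∑ j, siteSign c j = β := by
  have sq : ∀ s, c (.inl (s, 1, if siteSign c (s, true) = siteSign c (s, false) then 2 else 1)) =
      c (.inl (s, 0, 0)) := fun s =>
    diagonal_eq_of_rook (L := fun r k => c (.inl (s, r, k)))
      (fun r k k' h => hc _ _ (by simp [siteAdj, h])) (fun r r' k h => hc _ _ (by simp [siteAdj, h]))
  have corner : c (.inl (true, 0, 0)) = c (.inl (false, 0, 0)) := by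
    have key : ∀ x y e e' : Fin 3, x ≠ e → x ≠ e' → y ≠ e → y ≠ e' → e ≠ e' → x = y := by decide
    exact key _ _ (c (.inr (.inr false))) (c (.inr (.inr true)))
      (hc _ _ (by simp [siteAdj])) (hc _ _ (by simp [siteAdj])) (hc _ _ (by simp [siteAdj]))
      (hc _ _ (by simp [siteAdj])) (hc _ _ (by simp [siteAdj]))
  -- The vertices of a triangle need three distinct colors, so the three cells attached to them
  -- cannot all share a color.
  have nae : ∀ k, ¬ (c (.inl (false, 1, if k then 2 else 1)) = c (.inl (false, 0, 0)) ∧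
      c (.inl (true, 1, if Bool.xor k (β = 1) then 1 else 2)) = c (.inl (false, 0, 0))) := by
    intro k
    have key : ∀ x y z n n' n'' : Fin 3, n ≠ x → n' ≠ y → n'' ≠ z → n ≠ n' → n ≠ n'' → n' ≠ n'' →
      ¬ (y = x ∧ z = x) := by decide
    exact key _ _ _ (c (.inr (.inl (k, 0)))) (c (.inr (.inl (k, 1)))) (c (.inr (.inl (k, 2))))
      (hc _ _ (by simp [siteAdj, cornerAdj])) (hc _ _ (by simp [siteAdj, cornerAdj]))
      (hc _ _ (by simp [siteAdj, cornerAdj])) (hc _ _ (by simp [siteAdj]))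
      (hc _ _ (by simp [siteAdj])) (hc _ _ (by simp [siteAdj]))
  have h0 := sq false
  have h1 := sq true
  rw [corner] at h1
  have n0 := nae false
  have n1 := nae true
  rw [Fintype.sum_prod_type, Fintype.sum_bool, Fintype.sum_bool, Fintype.sum_bool]
  generalize siteSign c (true, true) = a1 at *
  generalize siteSign c (true, false) = a2 at *
  generalize siteSign c (false, true) = a3 at *
  generalize siteSign c (false, false) = a4 at *
  have two : ∀ a : ZMod 2, a = 0 ∨ a = 1 := by decide
  by_contra hne
  rcases two β with rfl | rfl <;> rcases two a1 with rfl | rfl <;> rcases two a2 with rfl | rfl <;>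
    rcases two a3 with rfl | rfl <;> rcases two a4 with rfl | rfl <;>
    first
    | exact absurd (by decide) hne
    | exact n0 ⟨by simpa using h0, by simpa using h1⟩
    | exact n1 ⟨by simpa using h0, by simpa using h1⟩

theorem siteSign_eq_of_link {β β' : ZMod 2} {c c' : Site → Fin 3} {j : Bool × Bool}
    (hc : ∀ γ γ', siteAdj β γ γ' = true → c γ ≠ c γ')
    (hc' : ∀ γ γ', siteAdj β' γ γ' = true → c' γ ≠ c' γ')
    (hl : ∀ γ γ', siteSquare γ = j.1 → linkSite j.2 true γ = some γ' → c γ ≠ c' γ') :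
    siteSign c j = siteSign c' j := by
  obtain ⟨s, col⟩ := j
  let line : Fin 3 → Fin 3 → Site := fun a k => if col then .inl (s, k, a) else .inl (s, a, k)
  have hin : ∀ (β : ZMod 2) a k k', k ≠ k' → siteAdj β (line a k) (line a k') = true := by
    intro β a k k' h
    cases col <;> simp [line, siteAdj, h]
  have hout : ∀ (β : ZMod 2) k, siteAdj β (line 1 k) (line 0 k) = true := by
    intro β k
    cases col <;> simp [line, siteAdj]
  have hlink : ∀ k, linkSite col true (line 0 k) = some (line 1 k) := by
    intro k
    cases col <;> simp [line, linkSite]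
  have hs : ∀ k, siteSquare (line 0 k) = s := by
    intro k
    cases col <;> rfl
  have e : ∀ c : Site → Fin 3, siteSign c (s, col) = pairSign (c (line 0 0)) (c (line 0 1)) := by
    intro c
    cases col <;> rfl
  have h01 : (0 : Fin 3) ≠ 1 := by decide
  have h02 : (0 : Fin 3) ≠ 2 := by decide
  have h12 : (1 : Fin 3) ≠ 2 := by decide
  rw [e, e]
  refine (pairSign_eq_of_prism _ _ (c (line 0 2)) ⟨?_, ?_, ?_⟩
    (c' (line 1 0)) (c' (line 1 1)) (c' (line 1 2)) ⟨?_, ?_, ?_⟩ ⟨?_, ?_, ?_⟩).trans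
    (pairSign_eq_of_prism _ _ (c' (line 1 2)) ⟨?_, ?_, ?_⟩ _ _ (c' (line 0 2)) ⟨?_, ?_, ?_⟩
      ⟨?_, ?_, ?_⟩) <;>
  first
  | exact hl _ _ (hs _) (hlink _)
  | exact hc _ _ (hin β _ _ _ (by assumption))
  | exact hc' _ _ (hin β' _ _ _ (by assumption))
  | exact hc' _ _ (hout β' _)

end Gadget

/-! ### Graphs given by adjacency lists, and padding with isolated vertices -/

section ListGraph

variable {U V : Type}

/-- The graph with given lists of neighbours. -/
def listGraph (nb : U → List U) (hs : ∀ v w, w ∈ nb v → v ∈ nb w) (hi : ∀ v, v ∉ nb v) :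
    SimpleGraph U where
  Adj v w := w ∈ nb v
  symm := ⟨fun v w h => hs v w h⟩
  loopless := ⟨hi⟩

/-- The oracle that lists the neighbours in the given order. -/
def listOracle (d : ℕ) (nb : U → List U) (a : U × Fin d) : Option U := (nb a.1)[(a.2 : ℕ)]?

variable {nb : U → List U} {hs : ∀ v w, w ∈ nb v → v ∈ nb w} {hi : ∀ v, v ∉ nb v}

theorem isAdjacencyOracle_listOracle (d : ℕ) (hn : ∀ v, (nb v).Nodup) :
    IsAdjacencyOracle (listGraph nb hs hi) (listOracle d nb) :=
  fun v => ⟨nb v, hn v, fun _ => Iff.rfl, fun _ => rfl⟩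

theorem degreeBounded_listGraph {d : ℕ} (hd : ∀ v, (nb v).length ≤ d) :
    DegreeBounded d (listGraph nb hs hi) := by
  classical
  intro v
  have h : (listGraph nb hs hi).neighborSet v = ((nb v).toFinset : Set U) := by
    ext w; simp [listGraph]
  rw [h]
  refine ⟨Finset.finite_toSet _, ?_⟩
  rw [Set.ncard_coe_finset]
  exact (List.toFinset_card_le _).trans (hd v)

/-- Lists of neighbours carried over along an embedding; the new vertices are isolated. -/
noncomputable def embedNeighbors (e : V ↪ U) (nb : V → List V) (u : U) : List U :=
  match Function.partialInv e u with
  | some v => (nb v).map e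
  | none => []

variable (e : V ↪ U) {lb : V → List V}

theorem embedNeighbors_apply (v : V) : embedNeighbors e lb (e v) = (lb v).map e := by
  simp [embedNeighbors, Function.partialInv_left e.injective]

theorem embedNeighbors_cases (u : U) :
    (∃ v, u = e v ∧ embedNeighbors e lb u = (lb v).map e) ∨ embedNeighbors e lb u = [] := by
  by_cases h : ∃ v, u = e v
  · obtain ⟨v, rfl⟩ := h
    exact Or.inl ⟨v, rfl, embedNeighbors_apply e v⟩
  · right
    have : Function.partialInv e u = none := by
      rw [Option.eq_none_iff_forall_not_mem]
      intro v hv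
      exact h ⟨v, ((e.injective.isPartialInv v u).1 hv).symm⟩
    simp [embedNeighbors, this]

theorem mem_embedNeighbors {u u' : U} :
    u' ∈ embedNeighbors e lb u ↔ ∃ v v', u = e v ∧ u' = e v' ∧ v' ∈ lb v := by
  constructor
  · intro h
    rcases embedNeighbors_cases e (lb := lb) u with ⟨v, rfl, hv⟩ | hu
    · rw [hv, List.mem_map] at h
      obtain ⟨v', hv', rfl⟩ := h
      exact ⟨v, v', rfl, rfl, hv'⟩
    · simp [hu] at h
  · rintro ⟨v, v', rfl, rfl, h⟩
    rw [embedNeighbors_apply]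
    exact List.mem_map_of_mem h

theorem embedNeighbors_symm (h : ∀ v w, w ∈ lb v → v ∈ lb w) (u u' : U)
    (hu : u' ∈ embedNeighbors e lb u) : u ∈ embedNeighbors e lb u' := by
  rw [mem_embedNeighbors] at hu ⊢
  obtain ⟨v, v', rfl, rfl, hv⟩ := hu
  exact ⟨v', v, rfl, rfl, h _ _ hv⟩

theorem embedNeighbors_irrefl (h : ∀ v, v ∉ lb v) (u : U) : u ∉ embedNeighbors e lb u := by
  rw [mem_embedNeighbors]
  rintro ⟨v, v', rfl, h', hv⟩
  rw [← e.injective h'] at hv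
  exact h v hv

theorem nodup_embedNeighbors (h : ∀ v, (lb v).Nodup) (u : U) : (embedNeighbors e lb u).Nodup := by
  rcases embedNeighbors_cases e (lb := lb) u with ⟨v, rfl, hv⟩ | hu
  · rw [hv]; exact (h v).map e.injective
  · simp [hu]

theorem length_embedNeighbors_le {d : ℕ} (h : ∀ v, (lb v).length ≤ d) (u : U) :
    (embedNeighbors e lb u).length ≤ d := by
  rcases embedNeighbors_cases e (lb := lb) u with ⟨v, rfl, hv⟩ | hu
  · rw [hv, List.length_map]; exact h v
  · simp [hu]

theorem colorable_of_embedNeighbors {hs hi} {c : V → Fin 3} (hc : ∀ v, ∀ w ∈ lb v, c v ≠ c w) :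
    (listGraph (embedNeighbors e lb) hs hi).Colorable 3 := by
  refine ⟨SimpleGraph.Coloring.mk (fun u => ((Function.partialInv e u).map c).getD 0) ?_⟩
  intro u u' h
  obtain ⟨v, v', rfl, rfl, hv⟩ := (mem_embedNeighbors e).1 h
  simpa [Function.partialInv_left e.injective] using hc v v' hv

open Classical in
/-- Edges that are monochromatic in a coloring of `H` do not belong to `H`. -/
theorem card_owner_monochromatic_le {M : Type} [Fintype M] [DecidableEq M] [Finite U] {hs hi}
    (owner : V → M) {H : SimpleGraph U} (C : H.Coloring (Fin 3)) :
    (Finset.univ.filter fun i => ∃ v, owner v = i ∧ ∃ w ∈ lb v, C (e v) = C (e w)).card ≤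
      2 * (symmDiff (listGraph (embedNeighbors e lb) hs hi).edgeSet H.edgeSet).ncard := by
  have := Fintype.ofFinite U
  rcases isEmpty_or_nonempty V with hV | hV
  · simp
  set E := symmDiff (listGraph (embedNeighbors e lb) hs hi).edgeSet H.edgeSet
  -- A monochromatic edge is missing from `H`, so it lies in the symmetric difference. Each edge
  -- there is charged to the owners of its two ends, hence the factor 2.
  have hsub : (Finset.univ.filter fun i => ∃ v, owner v = i ∧ ∃ w ∈ lb v, C (e v) = C (e w)) ⊆
      E.toFinset.biUnion fun s => s.toFinset.image fun u => owner (Function.invFun e u) := by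
    intro i hi'
    obtain ⟨v, rfl, w, hw, hC⟩ := (Finset.mem_filter.1 hi').2
    refine Finset.mem_biUnion.2 ⟨s(e v, e w), ?_, ?_⟩
    · rw [Set.mem_toFinset]
      refine Or.inl ⟨?_, ?_⟩
      · exact (mem_embedNeighbors e).2 ⟨v, w, rfl, rfl, hw⟩
      · intro h
        exact C.valid h hC
    · refine Finset.mem_image.2 ⟨e v, by simp, ?_⟩
      rw [Function.leftInverse_invFun e.injective v]
  refine (Finset.card_le_card hsub).trans ?_
  rw [Set.ncard_eq_toFinset_card', mul_comm]
  refine Finset.card_biUnion_le_card_mul _ _ _ fun s _ => Finset.card_image_le.trans ?_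
  rw [Sym2.card_toFinset]
  split_ifs <;> omega

end ListGraph

/-! ### The graph of a system of parity checks, and decoding of colorings -/

section System

/-- The ports of a vertex of a gadget: one for each potential neighbour within the gadget and
one for each kind of link. -/
abbrev SitePort := Site ⊕ (Bool × Bool)

variable {M : Type}

/-- The matching of the ports of the gadgets of a system of parity checks with right hand sides
`b`; the links follow the permutations `ρ` of the checks. -/
def checkPartner (ρ : Bool × Bool → Equiv.Perm M) (b : M → ZMod 2) (a : (M × Site) × SitePort) :
    Option ((M × Site) × SitePort) :=
  match a with
  | ((i, γ), .inl γ') => if siteAdj (b i) γ γ' then some ((i, γ'), .inl γ) else none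
  | ((i, γ), .inr (col, out)) => (linkSite col out γ).map fun γ' =>
      (((if out then ρ (siteSquare γ, col) else (ρ (siteSquare γ, col)).symm) i, γ'),
        .inr (col, !out))

variable {ρ : Bool × Bool → Equiv.Perm M} {b : M → ZMod 2}

theorem checkPartner_symm (a a' : (M × Site) × SitePort) (h : checkPartner ρ b a = some a') :
    checkPartner ρ b a' = some a := by
  obtain ⟨⟨i, γ⟩, γ' | ⟨col, out⟩⟩ := a
  · simp only [checkPartner, Option.ite_none_right_eq_some, Option.some.injEq] at h
    obtain ⟨h, rfl⟩ := h
    rw [siteAdj_symm] at h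
    simp [checkPartner, h]
  · simp only [checkPartner, Option.map_eq_some_iff] at h
    obtain ⟨γ', h, rfl⟩ := h
    obtain ⟨h1, h2⟩ := linkSite_symm h
    cases out <;> simp only [checkPartner, h1, h2] <;> simp

theorem checkPartner_ne_self (a : (M × Site) × SitePort) : checkPartner ρ b a ≠ some a := by
  intro h
  obtain ⟨⟨i, γ⟩, γ' | ⟨col, out⟩⟩ := a
  · simp only [checkPartner, Option.ite_none_right_eq_some, Option.some.injEq, Prod.mk.injEq,
      Sum.inl.injEq] at h
    obtain ⟨h, ⟨-, rfl⟩, -⟩ := h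
    simp [siteAdj_irrefl] at h
  · simp only [checkPartner, Option.map_eq_some_iff] at h
    obtain ⟨γ', -, h⟩ := h
    simp at h

theorem checkPartner_congr {b' : M → ZMod 2} {a : (M × Site) × SitePort}
    (h : b a.1.1 = b' a.1.1) : checkPartner ρ b a = checkPartner ρ b' a := by
  obtain ⟨⟨i, γ⟩, γ' | ⟨col, out⟩⟩ := a
  · simp only [checkPartner]; rw [show b i = b' i from h]
  · rfl

theorem siteColor_checkPartner_ne {τ : M → Bool × Bool → ZMod 2} (hb : ∀ i, ∑ j, τ i j = b i)
    (hρ : ∀ i j, τ (ρ j i) j = τ i j) (a a' : (M × Site) × SitePort)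
    (h : checkPartner ρ b a = some a') :
    siteColor (τ a.1.1) a.1.2 ≠ siteColor (τ a'.1.1) a'.1.2 := by
  obtain ⟨⟨i, γ⟩, γ' | ⟨col, out⟩⟩ := a
  · simp only [checkPartner, Option.ite_none_right_eq_some, Option.some.injEq] at h
    obtain ⟨h, rfl⟩ := h
    rw [← hb] at h
    exact siteColor_ne _ h
  · simp only [checkPartner, Option.map_eq_some_iff] at h
    obtain ⟨γ', h, rfl⟩ := h
    cases out
    · obtain ⟨h1, h2⟩ := linkSite_symm h
      refine (siteColor_link_ne h1 ?_).symm
      rw [h2]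
      simpa using (hρ ((ρ (siteSquare γ, col)).symm i) (siteSquare γ, col)).symm
    · exact siteColor_link_ne h (by simpa using (hρ i (siteSquare γ, col)).symm)

/-- A proper coloring of the gadgets in which no edge at the checks `i` and `ρ j i` is
monochromatic gives a common variable of these checks the same value, and satisfies the check. -/
theorem siteSign_of_proper {nxt : Equiv.Perm SitePort} (hnxt : ∀ p p', nxt.SameCycle p p')
    (C : ((M × Site) × SitePort) × Fin 7 → Fin 3) (p₀ : SitePort) {i : M}
    (hi : ∀ γ p k, ∀ w ∈ chainNeighbors nxt (checkPartner ρ b) (((i, γ), p), k),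
      C (((i, γ), p), k) ≠ C w) :
    (∑ j, siteSign (fun γ => C (((i, γ), p₀), 0)) j = b i) ∧
    ∀ j, (∀ γ p k, ∀ w ∈ chainNeighbors nxt (checkPartner ρ b) (((ρ j i, γ), p), k),
      C (((ρ j i, γ), p), k) ≠ C w) →
      siteSign (fun γ => C (((i, γ), p₀), 0)) j =
        siteSign (fun γ => C (((ρ j i, γ), p₀), 0)) j := by
  have prop : ∀ i, (∀ γ p k, ∀ w ∈ chainNeighbors nxt (checkPartner ρ b) (((i, γ), p), k),
      C (((i, γ), p), k) ≠ C w) → ∀ γ γ', siteAdj (b i) γ γ' = true →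
      C (((i, γ), p₀), 0) ≠ C (((i, γ'), p₀), 0) := by
    intro i hi γ γ' h
    -- The common color of each chain is moved to the port that carries the edge in question.
    rw [← chain_color_eq hnxt (hi γ) (.inl γ') p₀, ← chain_color_eq hnxt (hi γ') (.inl γ) p₀]
    exact hi γ _ _ _ (by simp [chainNeighbors, checkPartner, h])
  refine ⟨sum_siteSign (prop i hi), fun j hj => ?_⟩
  refine siteSign_eq_of_link (prop i hi) (prop _ hj) fun γ γ' hs h => ?_
  rw [← chain_color_eq hnxt (hi γ) (.inr (j.2, true)) p₀,
    ← chain_color_eq hnxt (hj γ') (.inr (j.2, false)) p₀]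
  refine hi γ _ _ _ ?_
  simp [chainNeighbors, checkPartner, h, hs]

variable {q : ℕ}

/-- The left hand sides of the system of parity checks in which the `j`-th variable of the
check `i` is `(j, (π j i).1)`. -/
def checkMap (π : Bool × Bool → Equiv.Perm (Fin q × Fin 16)) :
    ((Bool × Bool) × Fin q → ZMod 2) →+ (Fin q × Fin 16 → ZMod 2) where
  toFun y i := ∑ j, y (j, (π j i).1)
  map_zero' := by funext i; simp
  map_add' y y' := by funext i; simp [Finset.sum_add_distrib]

/-- The permutation of the checks whose cycles are the sets of checks with a common `j`-th
variable. -/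
def checkShift (π : Bool × Bool → Equiv.Perm (Fin q × Fin 16)) (j : Bool × Bool) :
    Equiv.Perm (Fin q × Fin 16) :=
  (π j).trans (((Equiv.refl _).prodCongr (Equiv.addRight 1)).trans (π j).symm)

theorem exists_sum_checkMap_ne_zero {π : Bool × Bool → Equiv.Perm (Fin q × Fin 16)}
    {s : Finset (Fin q × Fin 16)} {j : Bool × Bool} {f : Fin q}
    (h : Odd (s.filter fun i => (π j i).1 = f).card) : ∃ y, ∑ i ∈ s, checkMap π y i ≠ 0 := by
  refine ⟨Pi.single (j, f) 1, ?_⟩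
  have : ∀ i, checkMap π (Pi.single (j, f) 1) i = if (π j i).1 = f then 1 else 0 := by
    intro i
    change ∑ j', (Pi.single (j, f) 1 : (Bool × Bool) × Fin q → ZMod 2) (j', (π j' i).1) = _
    rw [Finset.sum_eq_single j]
    · simp [Pi.single_apply]
    · intro j' _ hj
      simp [hj]
    · simp
  simp only [this, Finset.sum_boole]
  rw [ZMod.natCast_ne_zero_iff_odd]
  exact h

/-- Around the cycle of checks that share a variable, its decoded value is constant unless some
check is bad, that is, owns an end of a monochromatic edge. A check can thus be violated only if it
shares a variable at some position with a bad check, and each bad check accounts for at most `4 * 16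
= 64` such checks. -/
theorem exists_card_unsatisfied_le (π : Bool × Bool → Equiv.Perm (Fin q × Fin 16))
    (b : Fin q × Fin 16 → ZMod 2) {nxt : Equiv.Perm SitePort} (hnxt : ∀ p p', nxt.SameCycle p p')
    (C : (((Fin q × Fin 16) × Site) × SitePort) × Fin 7 → Fin 3) :
    ∃ y, (Finset.univ.filter fun i => checkMap π y i ≠ b i).card ≤
      64 * (Finset.univ.filter fun i => ∃ v : (((Fin q × Fin 16) × Site) × SitePort) × Fin 7,
        v.1.1.1 = i ∧ ∃ w ∈ chainNeighbors nxt (checkPartner (checkShift π) b) v,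
          C v = C w).card := by
  classical
  set B := Finset.univ.filter fun i => ∃ v : (((Fin q × Fin 16) × Site) × SitePort) × Fin 7,
        v.1.1.1 = i ∧ ∃ w ∈ chainNeighbors nxt (checkPartner (checkShift π) b) v, C v = C w
  have good : ∀ i ∉ B, ∀ γ p k, ∀ w ∈ chainNeighbors nxt (checkPartner (checkShift π) b)
      (((i, γ), p), k), C (((i, γ), p), k) ≠ C w := by
    intro i hi γ p k w hw h
    exact hi (Finset.mem_filter.2 ⟨Finset.mem_univ _, (((i, γ), p), k), rfl, w, hw, h⟩)
  let p₀ : SitePort := .inr (false, false)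
  let σ : Fin q × Fin 16 → Bool × Bool → ZMod 2 := fun i => siteSign fun γ => C (((i, γ), p₀), 0)
  -- The value of a variable is read off at the check numbered 0 among the 16 that contain it.
  refine ⟨fun v => σ ((π v.1).symm (v.2, 0)) v.1, ?_⟩
  have hsub : (Finset.univ.filter fun i =>
      checkMap π (fun v => σ ((π v.1).symm (v.2, 0)) v.1) i ≠ b i) ⊆
      B.biUnion fun i' => (Finset.univ : Finset ((Bool × Bool) × Fin 16)).image fun ja =>
        (π ja.1).symm ((π ja.1 i').1, ja.2) := by
    intro i hi
    by_contra hcon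
    have hB : ∀ j a, (π j).symm ((π j i).1, a) ∉ B := by
      intro j a h
      refine hcon (Finset.mem_biUnion.2 ⟨_, h, Finset.mem_image.2
        ⟨(j, (π j i).2), Finset.mem_univ _, ?_⟩⟩)
      simp
    have hiB : i ∉ B := by simpa using hB (false, false) (π (false, false) i).2
    refine (Finset.mem_filter.1 hi).2 ?_
    rw [← (siteSign_of_proper hnxt C p₀ (good i hiB)).1]
    change ∑ j, σ ((π j).symm ((π j i).1, 0)) j = ∑ j, σ i j
    refine Finset.sum_congr rfl fun j _ => ?_
    have step : ∀ a, σ ((π j).symm ((π j i).1, a + 1)) j = σ ((π j).symm ((π j i).1, a)) j := by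
      intro a
      have hsh : checkShift π j ((π j).symm ((π j i).1, a)) = (π j).symm ((π j i).1, a + 1) := by
        simp [checkShift]
      have := (siteSign_of_proper hnxt C p₀ (good _ (hB j a))).2 j
        (by rw [hsh]; exact good _ (hB j (a + 1)))
      rw [hsh] at this
      exact this.symm
    have all : ∀ a : Fin 16, σ ((π j).symm ((π j i).1, a)) j =
        σ ((π j).symm ((π j i).1, 0)) j := by
      intro a
      induction a using Fin.induction with
      | zero => rfl
      | succ a ih => rw [← ih, ← Fin.coeSucc_eq_succ, step]
    rw [← all (π j i).2]
    simp
  refine (Finset.card_le_card hsub).trans ?_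
  rw [mul_comm]
  refine Finset.card_biUnion_le_card_mul _ _ _ fun i' _ => Finset.card_image_le.trans ?_
  simp

end System

theorem exists_perm_sameCycle (α : Type) [Fintype α] [DecidableEq α] :
    ∃ f : Equiv.Perm α, ∀ a b, f.SameCycle a b := by
  obtain ⟨f, hf, -⟩ := Finset.exists_cycleOn (Finset.univ : Finset α)
  exact ⟨f, fun a b => hf.2 (by simp) (by simp)⟩

/-! ### The hard instances and the query bound -/

section Instance

variable {q N : ℕ}

/-- The vertices of the graph of a system of parity checks. -/
abbrev CheckVertex (q : ℕ) := (((Fin q × Fin 16) × Site) × SitePort) × Fin 7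

theorem card_checkVertex (q : ℕ) : Fintype.card (CheckVertex q) = 87360 * q := by
  simp [Fintype.card_prod, Fintype.card_sum]
  ring

/-- The adjacency lists of the graph, on `N` vertices, of the system of parity checks with the
right hand sides `b`. -/
noncomputable def checkLists (π : Bool × Bool → Equiv.Perm (Fin q × Fin 16))
    (nxt : Equiv.Perm SitePort) (e : CheckVertex q ↪ Fin N) (b : Fin q × Fin 16 → ZMod 2) :
    Fin N → List (Fin N) :=
  embedNeighbors e (chainNeighbors nxt (checkPartner (checkShift π) b))

variable (π : Bool × Bool → Equiv.Perm (Fin q × Fin 16)) (nxt : Equiv.Perm SitePort)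
  (e : CheckVertex q ↪ Fin N) (b : Fin q × Fin 16 → ZMod 2)

/-- The graph, on `N` vertices, of the system of parity checks with the right hand sides `b`. -/
noncomputable def checkGraph : SimpleGraph (Fin N) :=
  listGraph (checkLists π nxt e b)
    (embedNeighbors_symm e fun _ _ => mem_chainNeighbors_symm checkPartner_symm)
    (embedNeighbors_irrefl e (not_mem_chainNeighbors_self checkPartner_ne_self))

theorem degreeBounded_checkGraph {d : ℕ} (hd : 4 ≤ d) : DegreeBounded d (checkGraph π nxt e b) :=
  degreeBounded_listGraph (length_embedNeighbors_le e fun v =>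
    (length_chainNeighbors_le v).trans hd)

theorem isAdjacencyOracle_checkGraph (d : ℕ) :
    IsAdjacencyOracle (checkGraph π nxt e b) (listOracle d (checkLists π nxt e b)) :=
  isAdjacencyOracle_listOracle d (nodup_embedNeighbors e nodup_chainNeighbors)

theorem colorable_checkGraph (y : (Bool × Bool) × Fin q → ZMod 2) :
    (checkGraph π nxt e (checkMap π y)).Colorable 3 :=
  colorable_of_embedNeighbors e (c := chainColor fun x : (Fin q × Fin 16) × Site =>
      siteColor (fun j => y (j, (π j x.1).1)) x.2)
    fun _ _ h => chainColor_ne (siteColor_checkPartner_ne (τ := fun i j => y (j, (π j i).1))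
      (fun _ => rfl) fun i j => by simp [checkShift]) h

theorem exists_card_unsatisfied_le_symmDiff (hnxt : ∀ p p', nxt.SameCycle p p')
    {H : SimpleGraph (Fin N)} (hH : H.Colorable 3) :
    ∃ y, (Finset.univ.filter fun i => checkMap π y i ≠ b i).card ≤
      128 * (symmDiff (checkGraph π nxt e b).edgeSet H.edgeSet).ncard := by
  obtain ⟨C⟩ := hH
  obtain ⟨y, hy⟩ := exists_card_unsatisfied_le π b hnxt fun v => C (e v)
  refine ⟨y, hy.trans ?_⟩
  have h := card_owner_monochromatic_le e
    (lb := chainNeighbors nxt (checkPartner (checkShift π) b))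
    (hs := embedNeighbors_symm e fun _ _ => mem_chainNeighbors_symm checkPartner_symm)
    (hi := embedNeighbors_irrefl e (not_mem_chainNeighbors_self checkPartner_ne_self))
    (fun v => v.1.1.1) C
  change _ ≤ 2 * (symmDiff (checkGraph π nxt e b).edgeSet H.edgeSet).ncard at h
  have h2 := Nat.mul_le_mul_left 64 h
  rw [← mul_assoc] at h2
  refine (le_of_eq ?_).trans h2
  congr!

theorem farFromThreeColorable_checkGraph (hnxt : ∀ p p', nxt.SameCycle p p') {ε : ℝ} {d : ℕ}
    (hε : 128 * (ε * (N * d)) ≤ q)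
    (hb : ∀ y, q < (Finset.univ.filter fun i => checkMap π y i ≠ b i).card) :
    FarFromThreeColorable ε d (checkGraph π nxt e b) := by
  intro H _ hH
  obtain ⟨y, hy⟩ := exists_card_unsatisfied_le_symmDiff π nxt e b hnxt hH
  have h1 : ((q : ℕ) : ℝ) ≤
      ((128 * (symmDiff (checkGraph π nxt e b).edgeSet H.edgeSet).ncard : ℕ) : ℝ) :=
    Nat.cast_le.2 ((hb y).le.trans hy)
  push_cast at h1
  rw [Fintype.card_fin]
  linarith

variable {π nxt e b}

/-- Each entry of the adjacency lists depends on a single right hand side. -/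
theorem exists_listOracle_congr (hq : 1 ≤ q) (d : ℕ) : ∃ j : Fin N × Fin d → Fin q × Fin 16,
    ∀ a b b', b (j a) = b' (j a) →
      listOracle d (checkLists π nxt e b) a = listOracle d (checkLists π nxt e b') a := by
  -- The default check is assigned to the isolated vertices, whose lists are empty for every `b`.
  refine ⟨fun a => ((Function.partialInv e a.1).map fun v => v.1.1.1).getD (⟨0, hq⟩, 0), ?_⟩
  rintro ⟨u, i⟩ b b' h
  simp only [listOracle, checkLists, embedNeighbors]
  cases hu : Function.partialInv e u with
  | none => rfl
  | some v =>
    simp only [hu, Option.map_some, Option.getD_some] at h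
    simp only [chainNeighbors_congr (nxt := nxt)
      (checkPartner_congr (ρ := checkShift π) (a := v.1) h)]

/-- A tester makes linearly many queries. -/
theorem lt_queries_of_tester {d : ℕ} (hd : 4 ≤ d) (hq : 1 ≤ q) (hN : 87360 * q ≤ N) {ε : ℝ}
    (hε : 128 * (ε * (N * d)) ≤ q) {Z W : Type} [Fintype Z] [DecidableEq Z] [Fintype W]
    [DecidableEq W] {op : Option (Fin N) → Equiv.Perm Z}
    {A : QuantumQueryAlgorithm (Fin N × Fin d) Z W} (hA : IsThreeColorabilityTester ε d op A) :
    q < A.queries * 2 ^ 30 := by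
  classical
  by_contra! hlt
  -- With `R` the number of queries, independence holds for sets of size up to `2 * R`, the degree
  -- of the acceptance probability.
  obtain ⟨π, hπ⟩ := exists_perms_odd_fiber (J := Bool × Bool) (by simp) hlt
  obtain ⟨nxt, hnxt⟩ := exists_perm_sameCycle SitePort
  obtain ⟨e⟩ : Nonempty (CheckVertex q ↪ Fin N) :=
    Function.Embedding.nonempty_of_card_le (by rw [card_checkVertex, Fintype.card_fin]; exact hN)
  obtain ⟨j, hj⟩ := exists_listOracle_congr (π := π) (nxt := nxt) (e := e) hq d
  let p : (Fin q × Fin 16 → ZMod 2) → ℝ := fun b =>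
    A.acceptProb op (listOracle d (checkLists π nxt e b))
  have test := fun b => hA _ _ (degreeBounded_checkGraph π nxt e b hd)
    (isAdjacencyOracle_checkGraph π nxt e b d)
  have avg := card_mul_sum_eq_of_lowDegree (checkMap π) (k := A.queries + A.queries)
    (fun s hs hc => by
      obtain ⟨j, f, hodd⟩ := hπ s hs (by omega)
      exact exists_sum_checkMap_ne_zero hodd)
    (A.acceptProb_mem_lowDegree op _ j hj)
  have avg' : (Fintype.card (Fin q × Fin 16 → ZMod 2) : ℝ) * ∑ y, p (checkMap π y) =
      (Fintype.card ((Bool × Bool) × Fin q → ZMod 2) : ℝ) * ∑ b, p b := by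
    exact_mod_cast avg
  have lower : (Fintype.card ((Bool × Bool) × Fin q → ZMod 2) : ℝ) * (2 / 3) ≤
      ∑ y, p (checkMap π y) := by
    rw [← nsmul_eq_mul]
    exact Finset.card_nsmul_le_sum _ _ _ fun y _ => (test _).1 (colorable_checkGraph π nxt e y)
  set near := Finset.univ.filter fun b : Fin q × Fin 16 → ZMod 2 =>
    ∃ y, (Finset.univ.filter fun i => checkMap π y i ≠ b i).card ≤ q with hnear
  have hn := four_mul_card_near_le (M := Fin q × Fin 16) (Y := (Bool × Bool) × Fin q) hq
    (by simp [mul_comm]) (by simp) (checkMap π)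
  rw [← hnear] at hn
  -- Near right hand sides carry no promise, so the trivial bound 1 = 1/3 + 2/3 is used for them.
  have upper : ∑ b, p b ≤ ∑ b, (1 / 3 + if b ∈ near then 2 / 3 else 0 : ℝ) := by
    refine Finset.sum_le_sum fun b _ => ?_
    split_ifs with h
    · exact (A.acceptProb_le_one op _).trans (by norm_num)
    · rw [add_zero]
      refine (test b).2 (farFromThreeColorable_checkGraph π nxt e b hnxt hε fun y => ?_)
      by_contra! hy
      exact h (Finset.mem_filter.2 ⟨Finset.mem_univ _, y, hy⟩)
  rw [Finset.sum_add_distrib, Finset.sum_ite_mem, Finset.univ_inter, Finset.sum_const,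
    Finset.sum_const, Finset.card_univ, nsmul_eq_mul, nsmul_eq_mul] at upper
  have hn' : (4 : ℝ) * near.card ≤ Fintype.card (Fin q × Fin 16 → ZMod 2) := by exact_mod_cast hn
  have hB : (0 : ℝ) < Fintype.card (Fin q × Fin 16 → ZMod 2) := by
    exact_mod_cast Fintype.card_pos
  have hY : (0 : ℝ) < Fintype.card ((Bool × Bool) × Fin q → ZMod 2) := by
    exact_mod_cast Fintype.card_pos
  generalize (Fintype.card (Fin q × Fin 16 → ZMod 2) : ℝ) = B at *
  generalize (Fintype.card ((Bool × Bool) × Fin q → ZMod 2) : ℝ) = Y at *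
  have h1 := mul_le_mul_of_nonneg_left lower hB.le
  have h2 : ∑ b, p b ≤ B * (1 / 2) := by linarith
  have h3 := mul_le_mul_of_nonneg_left h2 hY.le
  have h4 := mul_pos hB hY
  linarith

end Instance

theorem theorem5p1 (d : ℕ) (hd : 4 ≤ d) :
    ∃ ε₀ : ℝ, 0 < ε₀ ∧ ε₀ < 1 ∧ ∀ ε : ℝ, 0 < ε → ε ≤ ε₀ →
      ∃ c : ℝ, 0 < c ∧ ∃ N₀ : ℕ, ∀ N : ℕ, N₀ ≤ N →
        ∀ (Z W : Type) [Fintype Z] [DecidableEq Z] [Fintype W] [DecidableEq W]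
          (op : Option (Fin N) → Equiv.Perm Z)
          (A : QuantumQueryAlgorithm (Fin N × Fin d) Z W),
          IsThreeColorabilityTester ε d op A → c * (N : ℝ) ≤ (A.queries : ℝ) := by
  have hd' : (4 : ℝ) ≤ d := by exact_mod_cast hd
  -- With `q = N / 87360` rounded down and `N ≥ 87360`, one has `N ≤ 2 * 87360 * q`. This factor 2
  -- turns the 128 of the distance bound into 256, and also enters `c`.
  refine ⟨1 / (256 * 87360 * d), by positivity, ?_, fun ε hε hε₀ =>
    ⟨1 / (2 * 87360 * 2 ^ 30), by positivity, 87360, ?_⟩⟩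
  · rw [div_lt_one (by positivity)]
    linarith
  intro N hN Z W _ _ _ _ op A hA
  have hq : 1 ≤ N / 87360 := Nat.div_pos hN (by norm_num)
  have hN1 : 87360 * (N / 87360) ≤ N := Nat.mul_div_le N 87360
  have hN2 : N ≤ 2 * 87360 * (N / 87360) := by omega
  have hN2' : (N : ℝ) ≤ 2 * 87360 * ((N / 87360 : ℕ) : ℝ) := by exact_mod_cast hN2
  have key := lt_queries_of_tester hd hq hN1 (ε := ε) (by
    rw [le_div_iff₀ (by positivity)] at hε₀
    have h := mul_le_mul_of_nonneg_right hε₀ (Nat.cast_nonneg (α := ℝ) N)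
    linarith) hA
  have key' : ((N / 87360 : ℕ) : ℝ) < A.queries * 2 ^ 30 := by exact_mod_cast key
  rw [one_div, inv_mul_le_iff₀ (by positivity)]
  linarith
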